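/- Let $d\ge 0$ be an integer. For $\psi,\xi\in L^2(\mathbb R^d)$ let $$W(\psi,\xi)(x,\omega)=\int_{\mathbb R^d}\psi\left(x+\tfrac t2\right)\overline{\xi\left(x-\tfrac t2\right)}\,e^{-2\pi i\,\omega\cdot t}\,dt ,\qquad (x,\omega)\in\mathbb R^{2d},$$ be the cross-Wigner distribution. The Weyl transform $\phi^w$ of a tempered distribution $\phi\in\mathcal S'(\mathbb R^{2d})$ is defined by $\langle\phi^w\xi,\psi\rangle=\langle\phi,W(\psi,\xi)\rangle$ for $\xi,\psi\in\mathcal S(\mathbb R^d)$, where brackets are antilinear in the second argument. Let $\mathcal W$ be the set of all $\phi\in\mathcal S'(\mathbb R^{2d})$ such that $\phi^w$ is (the restriction to $\mathcal S(\mathbb R^d)$ of) a density operator, that is, of a positive trace class operator on $L^2(\mathbb R^d)$ with trace $1$. Let $f\in L^1(\mathbb R^{2d})$ be real-valued with $f\ge 0$ almost everywhere and $\int_{\mathbb R^{2d}}f(z)\,dz=1$, and let $\phi\in\mathcal W$. Then $\phi$ is (given by) a function in $L^2(\mathbb R^{2d})$; the convolution $f\ast\phi$ exists almost everywhere, belongs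 to $L^2(\mathbb R^{2d})$, and $$f\ast\phi\in\mathcal W .$$ Moreover, for every $\psi\in L^2(\mathbb R^d)$ the Cohen's class distributions $Q_\phi(\psi)=W(\psi,\psi)\ast\phi$ and $Q_{f\ast\phi}(\psi)=W(\psi,\psi)\ast(f\ast\phi)$, as well as the convolution $f\ast Q_\phi(\psi)$, are given by absolutely convergent integrals at every point of $\mathbb R^{2d}$, and $$Q_{f\ast\phi}(\psi)=f\ast Q_\phi(\psi)\quad\text{everywhere on }\mathbb R^{2d}.$$ -/

import Mathlib

open MeasureTheory
open scoped SchwartzMap FourierTransform ContDiff InnerProductSpace ENNReal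

noncomputable section

namespace CohenClass

/-- The configuration space `ℝᵈ` with its Euclidean norm and Lebesgue measure. -/
abbrev Config (d : ℕ) : Type := EuclideanSpace ℝ (Fin d)

/-- The phase space `ℝ²ᵈ`, whose points are pairs `z = (x, ω)`, with Lebesgue measure. -/
abbrev Phase (d : ℕ) : Type := Config d × Config d

instance (d : ℕ) : (volume : Measure (Phase d)).IsAddHaarMeasure :=
  Measure.prod.instIsAddHaarMeasure _ _

/-- The Hilbert space `L²(ℝᵈ)`. -/
abbrev L2 (d : ℕ) : Type := Lp ℂ 2 (volume : Measure (Config d))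

/-! ### The Wigner distribution -/

/-- The cross-Wigner distribution
`W(ψ, ξ)(x, ω) = ∫ ψ(x + t/2) conj(ξ(x - t/2)) exp(-2πi ω · t) dt`;
Mathlib's Fourier transform is `𝓕 g ω = ∫ exp(-2πi ω · t) g(t) dt`. -/
def wigner {d : ℕ} (ψ ξ : Config d → ℂ) (z : Phase d) : ℂ :=
  𝓕 (fun t : Config d =>
    ψ (z.1 + (1 / 2 : ℝ) • t) * starRingEnd ℂ (ξ (z.1 - (1 / 2 : ℝ) • t))) z.2

/-! ### Schwartz functions: conjugates, tensor products, partial Fourier transform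

These show that the Wigner distribution of two Schwartz functions is a Schwartz function. -/

section Schwartz

variable {E F : Type} [NormedAddCommGroup E] [NormedSpace ℝ E]
  [NormedAddCommGroup F] [NormedSpace ℝ F]

/-- The complex conjugate of a Schwartz function. -/
def conjSchwartz (g : 𝓢(E, ℂ)) : 𝓢(E, ℂ) :=
  SchwartzMap.postcompCLM (𝕜 := ℝ) (Complex.conjCLE : ℂ →L[ℝ] ℂ) g

@[simp]
theorem conjSchwartz_apply (g : 𝓢(E, ℂ)) (x : E) :
    conjSchwartz g x = starRingEnd ℂ (g x) := rfl

theorem tensor_decay (f : 𝓢(E, ℂ)) (g : 𝓢(F, ℂ)) (k n : ℕ) :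
    ∃ C : ℝ, ∀ z : E × F,
      ‖z‖ ^ k * ‖iteratedFDeriv ℝ n (fun z : E × F => f z.1 * g z.2) z‖ ≤ C := by
  have hf : ContDiff ℝ ∞ (fun z : E × F => f z.1) := (f.smooth ⊤).comp contDiff_fst
  have hg : ContDiff ℝ ∞ (fun z : E × F => g z.2) := (g.smooth ⊤).comp contDiff_snd
  have h1 (i : ℕ) (z : E × F) : ‖iteratedFDeriv ℝ i (fun z : E × F => f z.1) z‖
      ≤ ‖iteratedFDeriv ℝ i f z.1‖ := by
    have := (ContinuousLinearMap.fst ℝ E F).iteratedFDeriv_comp_right (f.smooth ⊤) z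
      (i := i) (mod_cast le_top)
    have h2 : (fun z : E × F => f z.1) = f ∘ (ContinuousLinearMap.fst ℝ E F) := rfl
    rw [h2, this]
    refine (ContinuousMultilinearMap.norm_compContinuousLinearMap_le _ _).trans ?_
    refine mul_le_of_le_one_right (norm_nonneg _) ?_
    exact Finset.prod_le_one (fun _ _ => norm_nonneg _)
      (fun _ _ => ContinuousLinearMap.norm_fst_le ℝ E F)
  have h2 (i : ℕ) (z : E × F) : ‖iteratedFDeriv ℝ i (fun z : E × F => g z.2) z‖
      ≤ ‖iteratedFDeriv ℝ i g z.2‖ := by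
    have := (ContinuousLinearMap.snd ℝ E F).iteratedFDeriv_comp_right (g.smooth ⊤) z
      (i := i) (mod_cast le_top)
    have h2 : (fun z : E × F => g z.2) = g ∘ (ContinuousLinearMap.snd ℝ E F) := rfl
    rw [h2, this]
    refine (ContinuousMultilinearMap.norm_compContinuousLinearMap_le _ _).trans ?_
    refine mul_le_of_le_one_right (norm_nonneg _) ?_
    exact Finset.prod_le_one (fun _ _ => norm_nonneg _)
      (fun _ _ => ContinuousLinearMap.norm_snd_le ℝ E F)
  choose A hA0 hA using fun l i => f.decay l i
  choose B hB0 hB using fun l i => g.decay l i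
  refine ⟨∑ i ∈ Finset.range (n + 1), (n.choose i : ℝ) *
    (A k i * B 0 (n - i) + A 0 i * B k (n - i)), fun z => ?_⟩
  have hz : ‖z‖ ^ k ≤ ‖z.1‖ ^ k + ‖z.2‖ ^ k := by
    rw [Prod.norm_def]
    rcases max_cases ‖z.1‖ ‖z.2‖ with h | h <;> rw [h.1]
    · exact le_add_of_nonneg_right (by positivity)
    · exact le_add_of_nonneg_left (by positivity)
  have hL := norm_iteratedFDeriv_mul_le hf hg z (n := n) (mod_cast le_top)
  calc _ ≤ ‖z‖ ^ k * ∑ i ∈ Finset.range (n + 1), (n.choose i : ℝ) *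
        ‖iteratedFDeriv ℝ i (fun z : E × F => f z.1) z‖ *
        ‖iteratedFDeriv ℝ (n - i) (fun z : E × F => g z.2) z‖ := by gcongr
    _ ≤ (‖z.1‖ ^ k + ‖z.2‖ ^ k) * ∑ i ∈ Finset.range (n + 1), (n.choose i : ℝ) *
        ‖iteratedFDeriv ℝ i f z.1‖ * ‖iteratedFDeriv ℝ (n - i) g z.2‖ := by
        gcongr with i _
        · exact h1 i z
        · exact h2 (n - i) z
    _ ≤ _ := by
        rw [Finset.mul_sum]
        refine Finset.sum_le_sum fun i _ => ?_
        have e1 := hA k i z.1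
        have e2 := hA 0 i z.1
        have e3 := hB k (n - i) z.2
        have e4 := hB 0 (n - i) z.2
        simp only [pow_zero, one_mul] at e2 e4
        calc _ = (n.choose i : ℝ) * ((‖z.1‖ ^ k * ‖iteratedFDeriv ℝ i f z.1‖) *
              ‖iteratedFDeriv ℝ (n - i) g z.2‖ + ‖iteratedFDeriv ℝ i f z.1‖ *
              (‖z.2‖ ^ k * ‖iteratedFDeriv ℝ (n - i) g z.2‖)) := by ring
          _ ≤ _ := by
            gcongr
            · exact (hA0 k i).le
            · exact (hA0 0 i).le

/-- The tensor product `(x, y) ↦ f(x) g(y)` of two Schwartz functions. -/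
def tensorSchwartz (f : 𝓢(E, ℂ)) (g : 𝓢(F, ℂ)) : 𝓢(E × F, ℂ) where
  toFun z := f z.1 * g z.2
  smooth' := ((f.smooth ⊤).comp contDiff_fst).mul ((g.smooth ⊤).comp contDiff_snd)
  decay' := tensor_decay f g

end Schwartz

section PartialFourier

variable {d : ℕ} {V : Type} [NormedAddCommGroup V] [NormedSpace ℂ V]

/-- The Fourier transform in the second variable. -/
def partialFourier (G : Phase d → V) (z : Phase d) : V := 𝓕 (fun t => G (z.1, t)) z.2

theorem slice_bound (G : 𝓢(Phase d, V)) :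
    ∃ C : ℝ, ∀ x t : Config d, ‖G (x, t)‖ ≤
      C * (1 + ‖t‖) ^ (-((volume : Measure (Config d)).integrablePower : ℝ)) := by
  set N := (volume : Measure (Config d)).integrablePower
  refine ⟨2 ^ N * ((Finset.Iic (N, 0)).sup (fun m => SchwartzMap.seminorm ℝ m.1 m.2)) G,
    fun x t => ?_⟩
  have h := SchwartzMap.one_add_le_sup_seminorm_apply (𝕜 := ℝ) (m := (N, 0)) le_rfl le_rfl G (x, t)
  rw [norm_iteratedFDeriv_zero] at h
  rw [Real.rpow_neg (by positivity), Real.rpow_natCast, ← div_eq_mul_inv, le_div_iff₀ (by positivity),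
    mul_comm]
  refine le_trans ?_ h
  have : ‖t‖ ≤ ‖(x, t)‖ := norm_snd_le (x, t)
  gcongr

/-- The integrand of the derivative of the partial Fourier transform. -/
def partialFourierDeriv (G : 𝓢(Phase d, V)) : 𝓢(Phase d, Phase d →L[ℝ] V) :=
  SchwartzMap.postcompCLM (𝕜 := ℝ)
      ((ContinuousLinearMap.compL ℝ (Phase d) (Phase d) V).flip
        ((ContinuousLinearMap.inl ℝ (Config d) (Config d)).comp
          (ContinuousLinearMap.fst ℝ (Config d) (Config d))))
      (SchwartzMap.fderivCLM ℝ (Phase d) V G) +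
    (-(2 * Real.pi * Complex.I)) •
      SchwartzMap.bilinLeftCLM (𝕜 := ℝ) (ContinuousLinearMap.smulRightL ℝ (Phase d) V).flip
        (g := fun z : Phase d => (innerSL ℝ z.2).comp
          (ContinuousLinearMap.snd ℝ (Config d) (Config d)))
        (((((ContinuousLinearMap.compL ℝ (Phase d) (Config d) ℝ).flip
          (ContinuousLinearMap.snd ℝ (Config d) (Config d))).comp (innerSL ℝ)).comp
          (ContinuousLinearMap.snd ℝ (Config d) (Config d))).hasTemperateGrowth) G

theorem partialFourierDeriv_apply (G : 𝓢(Phase d, V)) (z v : Phase d) :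
    partialFourierDeriv G z v = fderiv ℝ G z (v.1, 0) +
      (-(2 * Real.pi * Complex.I)) • (⟪z.2, v.2⟫_ℝ • G z) := rfl

theorem partialFourier_eq (G : Phase d → V) (z : Phase d) :
    partialFourier G z =
      ∫ t : Config d, ((Real.fourierChar (-⟪t, z.2⟫_ℝ) : Circle) : ℂ) • G (z.1, t) := rfl

theorem hasFDerivAt_slice (G : 𝓢(Phase d, V)) (t : Config d) (w : Phase d) :
    HasFDerivAt (fun w : Phase d => G (w.1, t))
      ((fderiv ℝ G (w.1, t)).comp ((ContinuousLinearMap.inl ℝ (Config d) (Config d)).comp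
        (ContinuousLinearMap.fst ℝ (Config d) (Config d)))) w := by
  have h1 : (fun w : Phase d => G (w.1, t)) = fun w : Phase d => G ((0, t) +
      ((ContinuousLinearMap.inl ℝ (Config d) (Config d)).comp
        (ContinuousLinearMap.fst ℝ (Config d) (Config d))) w) := by
    funext w; simp
  have hw : HasFDerivAt (fun w : Phase d => (0, t) +
      ((ContinuousLinearMap.inl ℝ (Config d) (Config d)).comp
        (ContinuousLinearMap.fst ℝ (Config d) (Config d))) w)
      ((ContinuousLinearMap.inl ℝ (Config d) (Config d)).comp
      (ContinuousLinearMap.fst ℝ (Config d) (Config d))) w :=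
    (ContinuousLinearMap.hasFDerivAt _).const_add _
  have h2 := (G.hasFDerivAt ((0, t) +
      ((ContinuousLinearMap.inl ℝ (Config d) (Config d)).comp
        (ContinuousLinearMap.fst ℝ (Config d) (Config d))) w)).comp w hw
  rw [h1]
  have h3 : (w.1, t) = (0, t) +
      ((ContinuousLinearMap.inl ℝ (Config d) (Config d)).comp
        (ContinuousLinearMap.fst ℝ (Config d) (Config d))) w := by simp
  rw [h3]
  exact h2

theorem hasFDerivAt_char (t : Config d) (w : Phase d) :
    HasFDerivAt (fun w : Phase d => ((Real.fourierChar (-⟪t, w.2⟫_ℝ) : Circle) : ℂ))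
      (((Real.fourierChar (-⟪t, w.2⟫_ℝ) : Circle) : ℂ) • (-(2 * Real.pi * Complex.I)) •
        (Complex.ofRealCLM.comp ((innerSL ℝ t).comp
          (ContinuousLinearMap.snd ℝ (Config d) (Config d))))) w := by
  have hl : HasFDerivAt (fun w : Phase d =>
        -(2 * Real.pi * Complex.I) * ((⟪t, w.2⟫_ℝ : ℝ) : ℂ))
      ((-(2 * Real.pi * Complex.I)) • (Complex.ofRealCLM.comp ((innerSL ℝ t).comp
        (ContinuousLinearMap.snd ℝ (Config d) (Config d))))) w :=
    (Complex.ofRealCLM.comp ((innerSL ℝ t).comp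
        (ContinuousLinearMap.snd ℝ (Config d) (Config d)))).hasFDerivAt.const_mul _
  have h := hl.cexp
  have hw : ∀ w : Phase d, ((Real.fourierChar (-⟪t, w.2⟫_ℝ) : Circle) : ℂ) =
      Complex.exp (-(2 * Real.pi * Complex.I) * ((⟪t, w.2⟫_ℝ : ℝ) : ℂ)) := fun w => by
    rw [Real.fourierChar_apply]
    congr 1
    push_cast
    ring
  rw [hw w, funext hw]
  exact h

theorem hasFDerivAt_integrand (G : 𝓢(Phase d, V)) (t : Config d) (w : Phase d) :
    HasFDerivAt
      (fun w : Phase d => ((Real.fourierChar (-⟪t, w.2⟫_ℝ) : Circle) : ℂ) • G (w.1, t))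
      (((Real.fourierChar (-⟪t, w.2⟫_ℝ) : Circle) : ℂ) • partialFourierDeriv G (w.1, t)) w := by
  refine ((hasFDerivAt_char t w).smul (hasFDerivAt_slice G t w)).congr_fderiv ?_
  refine ContinuousLinearMap.ext fun v => ?_
  change ((Real.fourierChar (-⟪t, w.2⟫_ℝ) : Circle) : ℂ) • fderiv ℝ G (w.1, t) (v.1, 0) +
    (((Real.fourierChar (-⟪t, w.2⟫_ℝ) : Circle) : ℂ) • ((-(2 * Real.pi * Complex.I)) •
      ((⟪t, v.2⟫_ℝ : ℝ) : ℂ))) • G (w.1, t) =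
    ((Real.fourierChar (-⟪t, w.2⟫_ℝ) : Circle) : ℂ) • (fderiv ℝ G (w.1, t) (v.1, 0) +
      (-(2 * Real.pi * Complex.I)) • (⟪t, v.2⟫_ℝ • G (w.1, t)))
  rw [smul_add, smul_eq_mul, smul_eq_mul, mul_smul, mul_smul, Complex.coe_smul]

theorem norm_char_smul {W : Type} [NormedAddCommGroup W] [NormedSpace ℂ W] (r : ℝ) (v : W) :
    ‖((Real.fourierChar r : Circle) : ℂ) • v‖ = ‖v‖ := by
  rw [norm_smul, Circle.norm_coe, one_mul]

theorem continuous_integrand {W : Type} [NormedAddCommGroup W] [NormedSpace ℂ W]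
    (G : 𝓢(Phase d, W)) (w : Phase d) : Continuous
      (fun t : Config d => ((Real.fourierChar (-⟪t, w.2⟫_ℝ) : Circle) : ℂ) • G (w.1, t)) := by
  have h := Real.continuous_fourierChar
  have h1 : Continuous (fun t : Config d => Real.fourierChar (-⟪t, w.2⟫_ℝ)) :=
    h.comp (by fun_prop)
  exact (continuous_subtype_val.comp h1).smul (G.continuous.comp (by fun_prop))

theorem hasFDerivAt_partialFourier (G : 𝓢(Phase d, V)) (z : Phase d) :
    HasFDerivAt (partialFourier G) (partialFourier (partialFourierDeriv G) z) z := by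
  obtain ⟨C, hC⟩ := slice_bound G
  obtain ⟨C', hC'⟩ := slice_bound (partialFourierDeriv G)
  have hint := Measure.integrable_pow_neg_integrablePower (volume : Measure (Config d))
  exact hasFDerivAt_integral_of_dominated_of_fderiv_le
    (μ := (volume : Measure (Config d))) (s := Set.univ) (x₀ := z) (𝕜 := ℝ)
    (F := fun w t => ((Real.fourierChar (-⟪t, w.2⟫_ℝ) : Circle) : ℂ) • G (w.1, t))
    (F' := fun w t =>
      ((Real.fourierChar (-⟪t, w.2⟫_ℝ) : Circle) : ℂ) • partialFourierDeriv G (w.1, t))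
    (bound := fun t => C' *
      (1 + ‖t‖) ^ (-((volume : Measure (Config d)).integrablePower : ℝ)))
    Filter.univ_mem
    (Filter.Eventually.of_forall fun w => (continuous_integrand G w).aestronglyMeasurable)
    ((hint.const_mul C).mono' (continuous_integrand G z).aestronglyMeasurable
      (Filter.Eventually.of_forall fun t => (norm_char_smul _ _).le.trans (hC z.1 t)))
    (continuous_integrand (partialFourierDeriv G) z).aestronglyMeasurable
    (Filter.Eventually.of_forall fun t w _ => (norm_char_smul _ _).le.trans (hC' w.1 t))
    (hint.const_mul C')
    (Filter.Eventually.of_forall fun t w _ => hasFDerivAt_integrand G t w)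

/-- Uniform bounds for the derivatives of the slices of a Schwartz function. -/
theorem norm_iteratedFDeriv_slice_le (G : 𝓢(Phase d, V)) (p : ℕ) (x t : Config d) :
    ‖iteratedFDeriv ℝ p (fun t : Config d => G (x, t)) t‖ ≤ ‖iteratedFDeriv ℝ p G (x, t)‖ := by
  have h1 : (fun t : Config d => G (x, t)) = (fun w : Phase d => G ((x, 0) + w)) ∘
      (ContinuousLinearMap.inr ℝ (Config d) (Config d)) := by
    funext t; simp
  have hs : ContDiff ℝ ∞ (fun w : Phase d => G ((x, 0) + w)) :=
    (G.smooth ⊤).comp (contDiff_const.add contDiff_id)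
  rw [h1, ContinuousLinearMap.iteratedFDeriv_comp_right _ hs t (i := p) (mod_cast le_top),
    iteratedFDeriv_comp_add_left]
  refine (ContinuousMultilinearMap.norm_compContinuousLinearMap_le _ _).trans ?_
  simp only [ContinuousLinearMap.inr_apply, Prod.mk_add_mk, add_zero, zero_add]
  refine mul_le_of_le_one_right (norm_nonneg _) ?_
  exact Finset.prod_le_one (fun _ _ => norm_nonneg _)
    (fun _ _ => ContinuousLinearMap.norm_inr_le_one ℝ (Config d) (Config d))

theorem slice_pow_bound (G : 𝓢(Phase d, V)) (k j p : ℕ) :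
    ∃ C : ℝ, ∀ x t : Config d,
      ‖t‖ ^ j * ‖‖x‖ ^ k • iteratedFDeriv ℝ p (fun t : Config d => G (x, t)) t‖ ≤ C := by
  obtain ⟨C, -, hC⟩ := G.decay (j + k) p
  refine ⟨C, fun x t => le_trans ?_ (hC (x, t))⟩
  have h1 : ‖t‖ ≤ ‖(x, t)‖ := norm_snd_le (x, t)
  have h2 : ‖x‖ ≤ ‖(x, t)‖ := norm_fst_le (x, t)
  rw [norm_smul, norm_pow, norm_norm, ← mul_assoc, pow_add]
  gcongr
  exact norm_iteratedFDeriv_slice_le G p x t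

theorem exists_integral_slice_le (G : 𝓢(Phase d, V)) (k j p : ℕ) :
    ∃ C : ℝ, ∀ x : Config d,
      ‖x‖ ^ k * ∫ t, ‖t‖ ^ j * ‖iteratedFDeriv ℝ p (fun t : Config d => G (x, t)) t‖ ≤ C := by
  obtain ⟨C₁, h₁⟩ := slice_pow_bound G k 0 p
  obtain ⟨C₂, h₂⟩ := slice_pow_bound G k
    (j + (volume : Measure (Config d)).integrablePower) p
  refine ⟨_, fun x => le_trans (le_of_eq ?_) (integral_pow_mul_le_of_le_of_pow_mul_le (k := j)
    (fun t => by simpa using h₁ x t) (h₂ x))⟩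
  rw [← integral_const_mul]
  refine integral_congr_ae (Filter.Eventually.of_forall fun t => ?_)
  simp only [norm_smul, norm_pow, norm_norm]
  ring

theorem integrable_slice (G : 𝓢(Phase d, V)) (j p : ℕ) (x : Config d) :
    Integrable (fun t => ‖t‖ ^ j * ‖iteratedFDeriv ℝ p (fun t : Config d => G (x, t)) t‖) := by
  obtain ⟨C₁, h₁⟩ := slice_pow_bound G 0 0 p
  obtain ⟨C₂, h₂⟩ := slice_pow_bound G 0
    (j + (volume : Measure (Config d)).integrablePower) p
  have hs : ContDiff ℝ ∞ (fun t : Config d => G (x, t)) :=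
    (G.smooth ⊤).comp (contDiff_const.prodMk contDiff_id)
  exact integrable_of_le_of_pow_mul_le (fun t => by simpa using h₁ x t)
    (fun t => by simpa using h₂ x t)
    (hs.continuous_iteratedFDeriv (m := p) (mod_cast le_top)).aestronglyMeasurable

theorem partialFourier_decay_zero (G : 𝓢(Phase d, V)) (k : ℕ) :
    ∃ C : ℝ, ∀ z : Phase d, ‖z‖ ^ k * ‖partialFourier G z‖ ≤ C := by
  have hs : ∀ x : Config d, ContDiff ℝ ((⊤ : ℕ∞) : WithTop ℕ∞) (fun t : Config d => G (x, t)) :=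
    fun x => (G.smooth ⊤).comp (contDiff_const.prodMk contDiff_id)
  choose C hC using exists_integral_slice_le G
  refine ⟨C k 0 0 + 2 ^ k * ∑ p ∈ Finset.range (0 + 1) ×ˢ Finset.range (k + 1), C 0 p.1 p.2,
    fun z => ?_⟩
  have hz : ‖z‖ ^ k ≤ ‖z.1‖ ^ k + ‖z.2‖ ^ k := by
    rw [Prod.norm_def]
    rcases max_cases ‖z.1‖ ‖z.2‖ with h | h <;> rw [h.1]
    · exact le_add_of_nonneg_right (by positivity)
    · exact le_add_of_nonneg_left (by positivity)
  have b1 : ‖z.1‖ ^ k * ‖partialFourier G z‖ ≤ C k 0 0 := by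
    refine le_trans ?_ (hC k 0 0 z.1)
    gcongr
    simp only [pow_zero, one_mul, norm_iteratedFDeriv_zero]
    exact VectorFourier.norm_fourierIntegral_le_integral_norm _ _ _ _ _
  have b2 : ‖z.2‖ ^ k * ‖partialFourier G z‖ ≤
      2 ^ k * ∑ p ∈ Finset.range (0 + 1) ×ˢ Finset.range (k + 1), C 0 p.1 p.2 := by
    have := Real.pow_mul_norm_iteratedFDeriv_fourier_le (K := ⊤) (N := ⊤) (hs z.1)
      (fun j n _ _ => integrable_slice G j n z.1) (k := 0) (n := k) le_top le_top z.2
    rw [norm_iteratedFDeriv_zero] at this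
    refine this.trans ?_
    simp only [pow_zero, one_mul, Nat.cast_zero, mul_zero, zero_add]
    gcongr with p _
    simpa using hC 0 p.1 p.2 z.1
  calc _ ≤ (‖z.1‖ ^ k + ‖z.2‖ ^ k) * ‖partialFourier G z‖ := by gcongr
    _ = ‖z.1‖ ^ k * ‖partialFourier G z‖ + ‖z.2‖ ^ k * ‖partialFourier G z‖ := by ring
    _ ≤ _ := add_le_add b1 b2

end PartialFourier

theorem fderiv_partialFourier {d : ℕ} {V : Type} [NormedAddCommGroup V] [NormedSpace ℂ V]
    (G : 𝓢(Phase d, V)) :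
    fderiv ℝ (partialFourier G) = partialFourier (partialFourierDeriv G) :=
  funext fun z => (hasFDerivAt_partialFourier G z).fderiv

theorem partialFourier_contDiff_nat {d : ℕ} (n : ℕ) :
    ∀ {V : Type} [NormedAddCommGroup V] [NormedSpace ℂ V] (G : 𝓢(Phase d, V)),
      ContDiff ℝ n (partialFourier G) := by
  induction n with
  | zero =>
    intro V _ _ G
    exact contDiff_zero.2 (continuous_iff_continuousAt.2
      fun z => (hasFDerivAt_partialFourier G z).continuousAt)
  | succ n ih =>
    intro V _ _ G
    push_cast
    refine contDiff_succ_iff_fderiv.2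
      ⟨fun z => (hasFDerivAt_partialFourier G z).differentiableAt, by simp, ?_⟩
    rw [fderiv_partialFourier]
    exact ih _

theorem partialFourier_decay {d : ℕ} (n : ℕ) :
    ∀ {V : Type} [NormedAddCommGroup V] [NormedSpace ℂ V] (G : 𝓢(Phase d, V)) (k : ℕ),
      ∃ C : ℝ, ∀ z : Phase d, ‖z‖ ^ k * ‖iteratedFDeriv ℝ n (partialFourier G) z‖ ≤ C := by
  induction n with
  | zero =>
    intro V _ _ G k
    simpa only [norm_iteratedFDeriv_zero] using partialFourier_decay_zero G k
  | succ n ih =>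
    intro V _ _ G k
    obtain ⟨C, hC⟩ := ih (partialFourierDeriv G) k
    refine ⟨C, fun z => ?_⟩
    rw [← norm_iteratedFDeriv_fderiv, fderiv_partialFourier]
    exact hC z

/-- The partial Fourier transform of a Schwartz function, as a Schwartz function. -/
def partialFourierSchwartz {d : ℕ} (G : 𝓢(Phase d, ℂ)) : 𝓢(Phase d, ℂ) where
  toFun := partialFourier G
  smooth' := contDiff_infty.2 fun n => partialFourier_contDiff_nat n G
  decay' k n := partialFourier_decay n G k

/-- The linear change of variables `(x, t) ↦ (x + t/2, x - t/2)`. -/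
def wignerChange (d : ℕ) : Phase d ≃L[ℝ] Phase d :=
  ContinuousLinearEquiv.equivOfInverse
    ((ContinuousLinearMap.fst ℝ (Config d) (Config d) +
        (1 / 2 : ℝ) • ContinuousLinearMap.snd ℝ (Config d) (Config d)).prod
      (ContinuousLinearMap.fst ℝ (Config d) (Config d) -
        (1 / 2 : ℝ) • ContinuousLinearMap.snd ℝ (Config d) (Config d)))
    (((1 / 2 : ℝ) • (ContinuousLinearMap.fst ℝ (Config d) (Config d) +
        ContinuousLinearMap.snd ℝ (Config d) (Config d))).prod
      (ContinuousLinearMap.fst ℝ (Config d) (Config d) -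
        ContinuousLinearMap.snd ℝ (Config d) (Config d)))
    (fun z => by
      ext i
      · simp; ring
      · simp; ring)
    (fun z => by
      ext i
      · simp; ring
      · simp; ring)

/-- The cross-Wigner distribution of two Schwartz functions, as a Schwartz function. -/
def wignerSchwartz {d : ℕ} (ψ ξ : 𝓢(Config d, ℂ)) : 𝓢(Phase d, ℂ) :=
  partialFourierSchwartz (SchwartzMap.compCLMOfContinuousLinearEquiv ℝ (wignerChange d)
    (tensorSchwartz ψ (conjSchwartz ξ)))

@[simp]
theorem wignerSchwartz_apply {d : ℕ} (ψ ξ : 𝓢(Config d, ℂ)) (z : Phase d) :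
    wignerSchwartz ψ ξ z = wigner ψ ξ z := rfl

/-! ### Density operators -/

section Operators

variable {H : Type} [NormedAddCommGroup H] [InnerProductSpace ℂ H] [CompleteSpace H]

/-- `S` is of trace class: `S` is compact and `tr |S| < ∞`, where `|S| = (S* S)^(1/2)`. -/
def IsTraceClass (S : H →L[ℂ] H) : Prop :=
  IsCompactOperator S ∧
    ∀ (ι : Type) (e : HilbertBasis ι ℂ H), Summable fun i => (⟪e i, CFC.abs S (e i)⟫_ℂ).re

/-- `tr S = τ`: in every orthonormal basis `(eᵢ)`, the sum of the `⟨S eᵢ, eᵢ⟩` is `τ`. -/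
def HasTrace (S : H →L[ℂ] H) (τ : ℂ) : Prop :=
  ∀ (ι : Type) (e : HilbertBasis ι ℂ H), HasSum (fun i => ⟪e i, S (e i)⟫_ℂ) τ

/-- A density operator is a positive trace class operator with trace one. -/
def IsDensityOperator (S : H →L[ℂ] H) : Prop :=
  S.IsPositive ∧ IsTraceClass S ∧ HasTrace S 1

end Operators

/-! ### The Weyl transform and the symbols of density operators -/

/-- The sesquilinear form `⟨φʷ ξ, ψ⟩ = ⟨φ, W(ψ, ξ)⟩` of the Weyl transform of a tempered
distribution `φ`. Brackets are antilinear in the second slot, so that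
`⟨φ, g⟩` is the value of `φ` at the complex conjugate of `g`. -/
def weylForm {d : ℕ} (φ : 𝓢'(Phase d, ℂ)) (ξ ψ : 𝓢(Config d, ℂ)) : ℂ :=
  φ (conjSchwartz (wignerSchwartz ψ ξ))

/-- The Weyl transform of `φ` is (the restriction to Schwartz functions of) the bounded operator
`S` on `L²(ℝᵈ)`. -/
def IsWeylTransform {d : ℕ} (φ : 𝓢'(Phase d, ℂ)) (S : L2 d →L[ℂ] L2 d) : Prop :=
  ∀ ξ ψ : 𝓢(Config d, ℂ), ⟪ψ.toLp 2, S (ξ.toLp 2)⟫_ℂ = weylForm φ ξ ψ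

/-- The set `𝒲` of all tempered distributions whose Weyl transform is a density operator. -/
def densitySymbols (d : ℕ) : Set 𝓢'(Phase d, ℂ) :=
  {φ | ∃ S : L2 d →L[ℂ] L2 d, IsWeylTransform φ S ∧ IsDensityOperator S}

/-! ### Convolutions and Cohen's class -/

/-- The convolution `f ∗ g` of a real function with a complex function on phase space. -/
def conv {d : ℕ} (f : Phase d → ℝ) (g : Phase d → ℂ) : Phase d → ℂ :=
  convolution f g (ContinuousLinearMap.lsmul ℝ ℝ) volume

/-- The Cohen class distribution `Q_φ(ψ) = W(ψ, ψ) ∗ φ` of a function `φ` on phase space. -/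
def cohen {d : ℕ} (φ : Phase d → ℂ) (ψ : Config d → ℂ) : Phase d → ℂ :=
  convolution (wigner ψ ψ) φ (ContinuousLinearMap.mul ℂ ℂ) volume

end CohenClass

end

/-!
The Wigner transform obeys Moyal's identity `⟨W(ψ, ξ), W(ψ', ξ')⟩ = ⟨ψ, ψ'⟩ ⟨ξ', ξ⟩`
(`inner_wignerL`), first for Schwartz functions, by Plancherel's theorem in the second variable and
a linear change of variables, and then on `L²` by density. Everything rests on it.

*Density symbols are square integrable.* If `S` is positive with trace one and `(eⱼ)` is an
orthonormal basis, the functions `W(S eⱼ, eⱼ)` are mutually orthogonal with square norms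
`‖S eⱼ‖² ≤ ‖S‖ ⟨eⱼ, S eⱼ⟩`, so that `φ = ∑ⱼ W(S eⱼ, eⱼ)` converges in `L²`, and
`⟨W(ψ, ξ), φ⟩ = ⟨ψ, S ξ⟩` (`exists_symbol_of_isPositive`). That `φ` is the given distribution is the
uniqueness of the Weyl symbol (`eq_zero_of_weylForm_eq_zero`): a tempered distribution that kills
all conjugated Wigner functions of Schwartz functions vanishes. Since `W` is a partial Fourier
transform of a tensor product after a linear change of variables, and the partial Fourier transform
maps onto the Schwartz functions, it is enough that a distribution which kills all tensor products
vanishes. The operators `regularize X Y : g ↦ X · F (Y g)`, with `X`, `Y` tensor products and `F` the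
Fourier transform, preserve tensor products and are continuous from the `L²` norm to the Schwartz
topology, so density of tensor products in `L²` shows that the distribution kills their ranges;
the union of these ranges is dense, as one sees by dilating `X` and `Y`.

*Averaging.* The Wigner distribution is covariant under the unitary phase space shifts `U_y`
(`wigner_shift`). Fubini's theorem then gives, for the operator `S'` with symbol `f ∗ φ`,
`⟨ψ, S' ψ⟩ = ∫ f(y) ⟨U_y ψ, S U_y ψ⟩ dy` (`inner_weylOperator_conv`). So `S'` is positive, and as
each `U_y` maps orthonormal bases to orthonormal bases, its trace is `∫ f = 1`. A positive operator
of finite trace is Hilbert–Schmidt, hence compact, so `S'` is a density operator.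

*Cohen's class.* The integrand of `⟨g, f ∗ φ⟩` is absolutely integrable on the product space for
`f ∈ L¹` and `g, φ ∈ L²` (`integrable_mul_convolution_integrand`). Applied to
`g = W(ψ, ψ)(z - ·)` this yields both the convergence of the integrals at the point `z` and the
exchange of their order.
-/

noncomputable section

namespace CohenClass

/-! ### The Wigner distribution of square integrable functions -/

section WignerL2

variable {d : ℕ}

theorem map_add_smul_volume (x : Config d) {r : ℝ} (hr : r ≠ 0) :
    Measure.map (fun t : Config d => x + r • t) volume =
      ENNReal.ofReal |(r ^ d)⁻¹| • volume := by
  have h : (fun t : Config d => x + r • t) = (fun t => x + t) ∘ (fun t => r • t) := rfl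
  rw [h, ← Measure.map_map (by fun_prop) (by fun_prop), Measure.map_addHaar_smul _ hr,
    Measure.map_smul, (measurePreserving_add_left volume x).map_eq]
  simp

theorem quasiMeasurePreserving_add_smul (x : Config d) {r : ℝ} (hr : r ≠ 0) :
    Measure.QuasiMeasurePreserving (fun t : Config d => x + r • t) volume volume :=
  ⟨by fun_prop, by
    rw [map_add_smul_volume x hr]
    exact Measure.smul_absolutelyContinuous⟩

theorem eLpNorm_comp_add_smul (x : Config d) {r : ℝ} (hr : r ≠ 0) {g : Config d → ℂ}
    (hg : AEStronglyMeasurable g volume) :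
    eLpNorm (fun t => g (x + r • t)) 2 volume =
      ENNReal.ofReal |(r ^ d)⁻¹| ^ (1 / 2 : ℝ) * eLpNorm g 2 volume := by
  have h := eLpNorm_map_measure (p := 2) (g := g) (f := fun t : Config d => x + r • t)
    (μ := volume) (by
      rw [map_add_smul_volume x hr]
      exact hg.mono_ac Measure.smul_absolutelyContinuous) (by fun_prop)
  rw [map_add_smul_volume x hr, eLpNorm_smul_measure_of_ne_top (by simp)] at h
  rw [Function.comp_def] at h
  simpa using h.symm

/-- The integrand of the Wigner distribution, without the exponential. -/
def wignerIntegrand (ψ ξ : Config d → ℂ) (x t : Config d) : ℂ :=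
  ψ (x + (1 / 2 : ℝ) • t) * starRingEnd ℂ (ξ (x - (1 / 2 : ℝ) • t))

theorem wigner_def (ψ ξ : Config d → ℂ) (z : Phase d) :
    wigner ψ ξ z = 𝓕 (wignerIntegrand ψ ξ z.1) z.2 := rfl

theorem sub_half_smul (x t : Config d) : x - (1 / 2 : ℝ) • t = x + (-(1 / 2) : ℝ) • t := by
  rw [neg_smul, sub_eq_add_neg]

theorem memLp_comp_add_smul (x : Config d) {r : ℝ} (hr : r ≠ 0) {g : Config d → ℂ}
    (hg : MemLp g 2 volume) : MemLp (fun t => g (x + r • t)) 2 volume := by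
  refine ⟨hg.1.comp_quasiMeasurePreserving (quasiMeasurePreserving_add_smul x hr), ?_⟩
  rw [eLpNorm_comp_add_smul x hr hg.1]
  exact ENNReal.mul_lt_top (ENNReal.rpow_lt_top_of_nonneg (by norm_num) (by simp)) hg.2

theorem memLp_conj {α : Type*} [MeasurableSpace α] {μ : Measure α} {p : ℝ≥0∞} {g : α → ℂ}
    (hg : MemLp g p μ) : MemLp (fun t => starRingEnd ℂ (g t)) p μ := by
  exact hg.star

theorem integrable_wignerIntegrand {ψ ξ : Config d → ℂ} (hψ : MemLp ψ 2 volume)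
    (hξ : MemLp ξ 2 volume) (x : Config d) : Integrable (wignerIntegrand ψ ξ x) := by
  have h1 := memLp_comp_add_smul x (r := 1 / 2) (by norm_num) hψ
  have h2 := memLp_conj (memLp_comp_add_smul x (r := -(1 / 2)) (by norm_num) hξ)
  simp only [← sub_half_smul] at h2
  exact h1.integrable_mul h2

/-- The constant in the pointwise bound of the Wigner distribution by `L²` norms. -/
def wignerConst (d : ℕ) : ℝ≥0∞ :=
  ENNReal.ofReal |((1 / 2 : ℝ) ^ d)⁻¹| ^ (1 / 2 : ℝ) *
    ENNReal.ofReal |((-(1 / 2) : ℝ) ^ d)⁻¹| ^ (1 / 2 : ℝ)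

theorem wignerConst_ne_top (d : ℕ) : wignerConst d ≠ ⊤ :=
  ENNReal.mul_ne_top (ENNReal.rpow_ne_top_of_nonneg (by norm_num) (by simp))
    (ENNReal.rpow_ne_top_of_nonneg (by norm_num) (by simp))

theorem enorm_wigner_le {ψ ξ : Config d → ℂ} (hψ : MemLp ψ 2 volume)
    (hξ : MemLp ξ 2 volume) (z : Phase d) :
    ‖wigner ψ ξ z‖ₑ ≤ wignerConst d * (eLpNorm ψ 2 volume * eLpNorm ξ 2 volume) := by
  have h1 := memLp_comp_add_smul z.1 (r := 1 / 2) (by norm_num) hψ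
  have h2 := memLp_comp_add_smul z.1 (r := -(1 / 2)) (by norm_num) hξ
  have h3 := memLp_conj h2
  have h4 : ‖wigner ψ ξ z‖ₑ ≤ eLpNorm (wignerIntegrand ψ ξ z.1) 1 volume := by
    rw [wigner_def, Real.fourier_eq, eLpNorm_one_eq_lintegral_enorm]
    refine (enorm_integral_le_lintegral_enorm _).trans (le_of_eq ?_)
    refine lintegral_congr fun t => ?_
    rw [← ofReal_norm, ← ofReal_norm, Circle.norm_smul]
  refine h4.trans ?_
  have h5 : wignerIntegrand ψ ξ z.1 = (fun t => ψ (z.1 + (1 / 2 : ℝ) • t)) •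
      (fun t => starRingEnd ℂ (ξ (z.1 + (-(1 / 2) : ℝ) • t))) := by
    funext t
    simp [wignerIntegrand, sub_eq_add_neg]
  rw [h5]
  refine (eLpNorm_smul_le_mul_eLpNorm (p := 2) (q := 2) (r := 1) h3.1 h1.1).trans (le_of_eq ?_)
  have h6 : eLpNorm (fun t => starRingEnd ℂ (ξ (z.1 + (-(1 / 2) : ℝ) • t))) 2 volume =
      eLpNorm (fun t => ξ (z.1 + (-(1 / 2) : ℝ) • t)) 2 volume :=
    eLpNorm_congr_norm_ae (Filter.Eventually.of_forall fun t => by simp)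
  rw [h6, eLpNorm_comp_add_smul _ (by norm_num) hψ.1, eLpNorm_comp_add_smul _ (by norm_num) hξ.1,
    wignerConst]
  ring

theorem norm_wigner_le (ψ ξ : L2 d) (z : Phase d) :
    ‖wigner ψ ξ z‖ ≤ (wignerConst d).toReal * (‖ψ‖ * ‖ξ‖) := by
  have h := enorm_wigner_le (Lp.memLp ψ) (Lp.memLp ξ) z
  rw [Lp.norm_def, Lp.norm_def, ← ENNReal.toReal_mul, ← ENNReal.toReal_mul, ← toReal_enorm]
  exact ENNReal.toReal_mono (ENNReal.mul_ne_top (wignerConst_ne_top d)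
    (ENNReal.mul_ne_top (Lp.eLpNorm_ne_top ψ) (Lp.eLpNorm_ne_top ξ))) h

theorem wignerIntegrand_congr_ae {ψ ψ' ξ ξ' : Config d → ℂ} (hψ : ψ =ᵐ[volume] ψ')
    (hξ : ξ =ᵐ[volume] ξ') (x : Config d) :
    wignerIntegrand ψ ξ x =ᵐ[volume] wignerIntegrand ψ' ξ' x := by
  have h1 := (quasiMeasurePreserving_add_smul x (r := 1 / 2) (by norm_num)).ae_eq_comp hψ
  have h2 := (quasiMeasurePreserving_add_smul x (r := -(1 / 2)) (by norm_num)).ae_eq_comp hξ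
  filter_upwards [h1, h2] with t h1 h2
  simp only [Function.comp_apply, ← sub_half_smul] at h1 h2
  rw [wignerIntegrand, wignerIntegrand, h1, h2]

theorem fourier_congr_ae {g h : Config d → ℂ} (hgh : g =ᵐ[volume] h) : 𝓕 g = 𝓕 h := by
  funext η
  rw [Real.fourier_eq, Real.fourier_eq]
  exact integral_congr_ae (hgh.mono fun t ht => by simp only [ht])

/-- The Wigner distribution does not depend on the choice of representatives, at any point. -/
theorem wigner_congr_ae {ψ ψ' ξ ξ' : Config d → ℂ} (hψ : ψ =ᵐ[volume] ψ')
    (hξ : ξ =ᵐ[volume] ξ') : wigner ψ ξ = wigner ψ' ξ' := by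
  funext z
  rw [wigner_def, wigner_def, fourier_congr_ae (wignerIntegrand_congr_ae hψ hξ z.1)]

theorem fourier_add_apply {g h : Config d → ℂ} (hg : Integrable g) (hh : Integrable h)
    (η : Config d) : 𝓕 (g + h) η = 𝓕 g η + 𝓕 h η := by
  have := VectorFourier.fourierIntegral_add Real.continuous_fourierChar
    (L := innerₗ (Config d)) (by exact continuous_inner) hg hh
  exact congrFun this η

theorem fourier_const_mul (c : ℂ) (g : Config d → ℂ) (η : Config d) :
    𝓕 (fun t => c * g t) η = c * 𝓕 g η := by
  rw [Real.fourier_eq, Real.fourier_eq, ← integral_const_mul]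
  refine integral_congr_ae (Filter.Eventually.of_forall fun t => ?_)
  simp only [Circle.smul_def, smul_eq_mul]
  ring

theorem wigner_add_left (ψ ψ' ξ : L2 d) :
    wigner (ψ + ψ' : L2 d) ξ = wigner ψ ξ + wigner ψ' ξ := by
  rw [wigner_congr_ae (Lp.coeFn_add ψ ψ') (ae_eq_refl _)]
  funext z
  have h : wignerIntegrand (ψ + ψ' : Config d → ℂ) ξ z.1 =
      wignerIntegrand ψ ξ z.1 + wignerIntegrand ψ' ξ z.1 := by
    funext t
    simp only [wignerIntegrand, Pi.add_apply]
    ring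
  rw [wigner_def, h, fourier_add_apply (integrable_wignerIntegrand (Lp.memLp _) (Lp.memLp _) _)
    (integrable_wignerIntegrand (Lp.memLp _) (Lp.memLp _) _)]
  rfl

theorem wigner_add_right (ψ ξ ξ' : L2 d) :
    wigner ψ (ξ + ξ' : L2 d) = wigner ψ ξ + wigner ψ ξ' := by
  rw [wigner_congr_ae (ae_eq_refl _) (Lp.coeFn_add ξ ξ')]
  funext z
  have h : wignerIntegrand ψ (ξ + ξ' : Config d → ℂ) z.1 =
      wignerIntegrand ψ ξ z.1 + wignerIntegrand ψ ξ' z.1 := by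
    funext t
    simp only [wignerIntegrand, Pi.add_apply, map_add]
    ring
  rw [wigner_def, h, fourier_add_apply (integrable_wignerIntegrand (Lp.memLp _) (Lp.memLp _) _)
    (integrable_wignerIntegrand (Lp.memLp _) (Lp.memLp _) _)]
  rfl

theorem wigner_smul_left (c : ℂ) (ψ ξ : L2 d) :
    wigner (c • ψ : L2 d) ξ = c • wigner ψ ξ := by
  rw [wigner_congr_ae (Lp.coeFn_smul c ψ) (ae_eq_refl _)]
  funext z
  have h : wignerIntegrand (c • ψ : Config d → ℂ) ξ z.1 =
      fun t => c * wignerIntegrand ψ ξ z.1 t := by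
    funext t
    simp only [wignerIntegrand, Pi.smul_apply, smul_eq_mul]
    ring
  rw [wigner_def, h, fourier_const_mul]
  rfl

theorem wigner_smul_right (c : ℂ) (ψ ξ : L2 d) :
    wigner ψ (c • ξ : L2 d) = starRingEnd ℂ c • wigner ψ ξ := by
  rw [wigner_congr_ae (ae_eq_refl _) (Lp.coeFn_smul c ξ)]
  funext z
  have h : wignerIntegrand ψ (c • ξ : Config d → ℂ) z.1 =
      fun t => starRingEnd ℂ c * wignerIntegrand ψ ξ z.1 t := by
    funext t
    simp only [wignerIntegrand, Pi.smul_apply, smul_eq_mul, map_mul]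
    ring
  rw [wigner_def, h, fourier_const_mul]
  rfl

theorem wigner_toLp (ψ ξ : 𝓢(Config d, ℂ)) :
    wigner (ψ.toLp 2 : L2 d) (ξ.toLp 2 : L2 d) = wigner ψ ξ :=
  wigner_congr_ae (ψ.memLp 2 volume).coeFn_toLp (ξ.memLp 2 volume).coeFn_toLp

/-! ### Moyal's identity -/

theorem measurePreserving_wignerChange (d : ℕ) :
    MeasurePreserving (wignerChange d) volume volume := by
  have h1 : MeasurePreserving (fun z : Phase d => (z.1, z.2 + (1 / 2 : ℝ) • z.1))
      volume volume :=
    (MeasurePreserving.id volume).skew_product (g := fun t x => x + (1 / 2 : ℝ) • t)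
      (by fun_prop)
      (Filter.Eventually.of_forall fun t => (measurePreserving_add_right volume _).map_eq)
  have h2 : MeasurePreserving (fun z : Phase d => (z.1, z.1 - z.2)) volume volume :=
    (MeasurePreserving.id volume).skew_product (g := fun p t => p - t) (by fun_prop)
      (Filter.Eventually.of_forall fun p => (Measure.measurePreserving_sub_left volume p).map_eq)
  -- The change of variables is a composition of two shears:
  -- `(x, t) ↦ (p, t) ↦ (p, p - t)` with `p = x + t / 2`.
  have h := h2.comp (Measure.measurePreserving_swap.comp (h1.comp Measure.measurePreserving_swap))
  refine (congrArg (fun g => MeasurePreserving g volume volume) (funext fun z => ?_)).mp h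
  refine Prod.ext rfl ?_
  change z.1 + (1 / 2 : ℝ) • z.2 - z.2 = z.1 - (1 / 2 : ℝ) • z.2
  module

/-- The restriction of a Schwartz function on phase space to the slice over `x`. -/
def sliceSchwartz {V : Type} [NormedAddCommGroup V] [NormedSpace ℂ V] (G : 𝓢(Phase d, V))
    (x : Config d) : 𝓢(Config d, V) where
  toFun t := G (x, t)
  smooth' := (G.smooth ⊤).comp (contDiff_const.prodMk contDiff_id)
  decay' k n := by
    obtain ⟨C, hC⟩ := slice_pow_bound G 0 k n
    exact ⟨C, fun t => by simpa using hC x t⟩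

theorem integral_conj_partialFourier_mul (G H : 𝓢(Phase d, ℂ)) :
    ∫ z, starRingEnd ℂ (partialFourierSchwartz G z) * partialFourierSchwartz H z =
      ∫ z, starRingEnd ℂ (G z) * H z := by
  have key : ∀ G H : 𝓢(Phase d, ℂ), Integrable (fun z => starRingEnd ℂ (G z) * H z) :=
    fun G H => (memLp_conj (G.memLp 2 volume)).integrable_mul (H.memLp 2 volume)
  rw [Measure.volume_eq_prod, integral_prod _ (key _ _), integral_prod _ (key _ _)]
  refine integral_congr_ae (Filter.Eventually.of_forall fun x => ?_)
  have h := SchwartzMap.integral_inner_fourier_fourier (sliceSchwartz G x) (sliceSchwartz H x)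
  simp only [RCLike.inner_apply'] at h
  exact h

/-- Moyal's identity for Schwartz functions. -/
theorem inner_wignerSchwartz (ψ ξ ψ' ξ' : 𝓢(Config d, ℂ)) :
    ⟪(wignerSchwartz ψ ξ).toLp 2 volume, (wignerSchwartz ψ' ξ').toLp 2 volume⟫_ℂ =
      ⟪ψ.toLp 2 volume, ψ'.toLp 2 volume⟫_ℂ * ⟪ξ'.toLp 2 volume, ξ.toLp 2 volume⟫_ℂ := by
  simp only [SchwartzMap.inner_toL2_toL2_eq, RCLike.inner_apply']
  rw [wignerSchwartz, wignerSchwartz, integral_conj_partialFourier_mul, ← integral_prod_mul]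
  have h := (measurePreserving_wignerChange d).integral_comp
    (wignerChange d).toHomeomorph.measurableEmbedding
    (fun z : Phase d => (starRingEnd ℂ (ψ z.1) * ψ' z.1) * (starRingEnd ℂ (ξ' z.2) * ξ z.2))
  refine Eq.trans (integral_congr_ae (Filter.Eventually.of_forall fun z => ?_)) h
  change starRingEnd ℂ (ψ (wignerChange d z).1 * starRingEnd ℂ (ξ (wignerChange d z).2)) *
    (ψ' (wignerChange d z).1 * starRingEnd ℂ (ξ' (wignerChange d z).2)) = _
  simp only [map_mul, Complex.conj_conj]
  ring

theorem exists_schwartz_tendsto (ψ : L2 d) :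
    ∃ s : ℕ → 𝓢(Config d, ℂ), Filter.Tendsto (fun n => ((s n).toLp 2 volume : L2 d)) Filter.atTop
      (nhds ψ) := by
  have h := SchwartzMap.denseRange_toLpCLM (E := Config d) (F := ℂ) (p := 2) (μ := volume)
    (by norm_num) ψ
  obtain ⟨x, hx, hlim⟩ := mem_closure_iff_seq_limit.1 h
  choose s hs using hx
  exact ⟨s, hlim.congr fun n => (hs n).symm⟩

theorem tendsto_apply_apply_of_sesquilinear {H V : Type*} [NormedAddCommGroup H] [NormedSpace ℂ H]
    [NormedAddCommGroup V] [NormedSpace ℂ V] (B : H →L[ℂ] H →L⋆[ℂ] V) {s r : ℕ → H} {ψ ξ : H}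
    (hs : Filter.Tendsto s Filter.atTop (nhds ψ)) (hr : Filter.Tendsto r Filter.atTop (nhds ξ)) :
    Filter.Tendsto (fun n => B (s n) (r n)) Filter.atTop (nhds (B ψ ξ)) := by
  have h1 : Filter.Tendsto (fun n => B (s n - ψ) (r n)) Filter.atTop (nhds 0) := by
    refine squeeze_zero_norm (fun n => B.le_opNorm₂ _ _) ?_
    have h := ((tendsto_iff_norm_sub_tendsto_zero.1 hs).const_mul ‖B‖).mul hr.norm
    simpa using h
  have h2 := h1.add (((B ψ).continuous.tendsto ξ).comp hr)
  rw [zero_add] at h2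
  refine h2.congr fun n => ?_
  simp

/-- The Wigner distribution at a fixed point is a bounded sesquilinear form on `L²`. -/
theorem tendsto_wigner {s r : ℕ → L2 d} {ψ ξ : L2 d} (hs : Filter.Tendsto s Filter.atTop (nhds ψ))
    (hr : Filter.Tendsto r Filter.atTop (nhds ξ)) (z : Phase d) :
    Filter.Tendsto (fun n => wigner (s n) (r n) z) Filter.atTop (nhds (wigner ψ ξ z)) := by
  let B : L2 d →L[ℂ] L2 d →L⋆[ℂ] ℂ := LinearMap.mkContinuous₂
    (LinearMap.mk₂'ₛₗ (RingHom.id ℂ) (starRingEnd ℂ) (fun ψ ξ : L2 d => wigner ψ ξ z)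
      (fun ψ ψ' ξ => congrFun (wigner_add_left ψ ψ' ξ) z)
      (fun c ψ ξ => congrFun (wigner_smul_left c ψ ξ) z)
      (fun ψ ξ ξ' => congrFun (wigner_add_right ψ ξ ξ') z)
      (fun c ψ ξ => congrFun (wigner_smul_right c ψ ξ) z))
    (wignerConst d).toReal (fun ψ ξ => (norm_wigner_le ψ ξ z).trans_eq (mul_assoc _ _ _).symm)
  exact tendsto_apply_apply_of_sesquilinear B hs hr

/-- The `L²` bound for the Wigner distribution: Schwartz functions satisfy it with equality by
Moyal's identity, and Fatou's lemma carries it over to pointwise limits. -/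
theorem aestronglyMeasurable_wigner_and_eLpNorm_le (ψ ξ : L2 d) : AEStronglyMeasurable (wigner ψ ξ) volume ∧
    eLpNorm (wigner ψ ξ) 2 volume ≤ ENNReal.ofReal (‖ψ‖ * ‖ξ‖) := by
  obtain ⟨s, hs⟩ := exists_schwartz_tendsto ψ
  obtain ⟨r, hr⟩ := exists_schwartz_tendsto ξ
  have hlim : ∀ᵐ z : Phase d, Filter.Tendsto (fun n => wignerSchwartz (s n) (r n) z) Filter.atTop
      (nhds (wigner ψ ξ z)) := Filter.Eventually.of_forall fun z => by
    have h := tendsto_wigner hs hr z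
    exact h.congr fun n => congrFun (wigner_toLp (s n) (r n)) z
  have hm : ∀ n, AEStronglyMeasurable (wignerSchwartz (s n) (r n)) volume :=
    fun n => (wignerSchwartz (s n) (r n)).continuous.aestronglyMeasurable
  refine ⟨aestronglyMeasurable_of_tendsto_ae _ hm hlim, ?_⟩
  refine (Lp.eLpNorm_lim_le_liminf_eLpNorm hm _ hlim).trans ?_
  have hn : ∀ n, eLpNorm (wignerSchwartz (s n) (r n)) 2 volume =
      ENNReal.ofReal (‖((s n).toLp 2 volume : L2 d)‖ * ‖((r n).toLp 2 volume : L2 d)‖) := by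
    intro n
    have h := inner_wignerSchwartz (s n) (r n) (s n) (r n)
    simp only [inner_self_eq_norm_sq_to_K] at h
    have h' : ‖(wignerSchwartz (s n) (r n)).toLp 2 volume‖ =
        ‖((s n).toLp 2 volume : L2 d)‖ * ‖((r n).toLp 2 volume : L2 d)‖ := by
      refine (sq_eq_sq₀ (norm_nonneg _) (by positivity)).1 ?_
      rw [mul_pow]
      exact_mod_cast h
    rw [← h', SchwartzMap.norm_toLp, ENNReal.ofReal_toReal]
    exact (SchwartzMap.memLp _ 2 volume).2.ne
  simp only [hn]
  have hc : Filter.Tendsto (fun n => ENNReal.ofReal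
      (‖((s n).toLp 2 volume : L2 d)‖ * ‖((r n).toLp 2 volume : L2 d)‖)) Filter.atTop
      (nhds (ENNReal.ofReal (‖ψ‖ * ‖ξ‖))) :=
    (ENNReal.continuous_ofReal.tendsto _).comp (hs.norm.mul hr.norm)
  exact hc.liminf_eq.le

theorem memLp_wigner (ψ ξ : L2 d) : MemLp (wigner ψ ξ) 2 volume :=
  ⟨(aestronglyMeasurable_wigner_and_eLpNorm_le ψ ξ).1,
    (aestronglyMeasurable_wigner_and_eLpNorm_le ψ ξ).2.trans_lt ENNReal.ofReal_lt_top⟩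

/-- The cross-Wigner distribution as a bounded sesquilinear map `L² × L² → L²`. -/
def wignerL (d : ℕ) : L2 d →L[ℂ] L2 d →L⋆[ℂ] Lp ℂ 2 (volume : Measure (Phase d)) :=
  LinearMap.mkContinuous₂
    (LinearMap.mk₂'ₛₗ (RingHom.id ℂ) (starRingEnd ℂ) (fun ψ ξ : L2 d => (memLp_wigner ψ ξ).toLp)
      (fun ψ ψ' ξ => by
        rw [← MemLp.toLp_add]
        exact MemLp.toLp_congr _ _ (by rw [wigner_add_left]))
      (fun c ψ ξ => by
        rw [RingHom.id_apply, ← MemLp.toLp_const_smul]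
        exact MemLp.toLp_congr _ _ (by rw [wigner_smul_left]))
      (fun ψ ξ ξ' => by
        rw [← MemLp.toLp_add]
        exact MemLp.toLp_congr _ _ (by rw [wigner_add_right]))
      (fun c ψ ξ => by
        rw [← MemLp.toLp_const_smul]
        exact MemLp.toLp_congr _ _ (by rw [wigner_smul_right])))
    1 (fun ψ ξ => by
      change ‖(memLp_wigner ψ ξ).toLp‖ ≤ _
      rw [Lp.norm_toLp, one_mul]
      exact ENNReal.toReal_le_of_le_ofReal (by positivity)
        (aestronglyMeasurable_wigner_and_eLpNorm_le ψ ξ).2)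

theorem coeFn_wignerL (ψ ξ : L2 d) : wignerL d ψ ξ =ᵐ[volume] wigner ψ ξ :=
  (memLp_wigner ψ ξ).coeFn_toLp

theorem wignerL_toLp (ψ ξ : 𝓢(Config d, ℂ)) :
    wignerL d (ψ.toLp 2 volume) (ξ.toLp 2 volume) = (wignerSchwartz ψ ξ).toLp 2 volume := by
  refine Lp.ext ((coeFn_wignerL _ _).trans ?_)
  rw [wigner_toLp]
  exact ((wignerSchwartz ψ ξ).coeFn_toLp 2 volume).symm

/-- Moyal's identity. -/
theorem inner_wignerL (ψ ξ ψ' ξ' : L2 d) :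
    ⟪wignerL d ψ ξ, wignerL d ψ' ξ'⟫_ℂ = ⟪ψ, ψ'⟫_ℂ * ⟪ξ', ξ⟫_ℂ := by
  obtain ⟨s, hs⟩ := exists_schwartz_tendsto ψ
  obtain ⟨r, hr⟩ := exists_schwartz_tendsto ξ
  obtain ⟨s', hs'⟩ := exists_schwartz_tendsto ψ'
  obtain ⟨r', hr'⟩ := exists_schwartz_tendsto ξ'
  have h1 := tendsto_apply_apply_of_sesquilinear (wignerL d) hs hr
  have h2 := tendsto_apply_apply_of_sesquilinear (wignerL d) hs' hr'
  have hn : ∀ n, ⟪wignerL d ((s n).toLp 2 volume) ((r n).toLp 2 volume),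
      wignerL d ((s' n).toLp 2 volume) ((r' n).toLp 2 volume)⟫_ℂ =
      ⟪((s n).toLp 2 volume : L2 d), (s' n).toLp 2 volume⟫_ℂ *
        ⟪((r' n).toLp 2 volume : L2 d), (r n).toLp 2 volume⟫_ℂ := fun n => by
    rw [wignerL_toLp, wignerL_toLp, inner_wignerSchwartz]
  have h3 := (hs.inner (𝕜 := ℂ) hs').mul (hr'.inner (𝕜 := ℂ) hr)
  have h4 := h1.inner (𝕜 := ℂ) h2
  simp only [hn] at h4
  exact tendsto_nhds_unique h4 h3

end WignerL2

/-! ### Continuity and surjectivity of the partial Fourier transform -/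

section PartialFourierCLM

variable {d : ℕ} {V : Type} [NormedAddCommGroup V] [NormedSpace ℂ V]

theorem exists_sup_seminorm_map_le {E F E' F' : Type*}
    [NormedAddCommGroup E] [NormedSpace ℝ E] [NormedAddCommGroup F] [NormedSpace ℝ F]
    [NormedAddCommGroup E'] [NormedSpace ℝ E'] [NormedAddCommGroup F'] [NormedSpace ℝ F']
    (A : 𝓢(E, F) →L[ℝ] 𝓢(E', F')) (s : Finset (ℕ × ℕ)) :
    ∃ (s' : Finset (ℕ × ℕ)) (C : ℝ), 0 ≤ C ∧ ∀ f : 𝓢(E, F),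
      s.sup (schwartzSeminormFamily ℝ E' F') (A f) ≤
        C * s'.sup (schwartzSeminormFamily ℝ E F) f := by
  have hc : Continuous ⇑(s.sup (schwartzSeminormFamily ℝ E' F')) :=
    Finset.sup_induction (p := fun q : Seminorm ℝ 𝓢(E', F') => Continuous q) continuous_const
      (fun p hp q hq => by
        change Continuous (⇑(p ⊔ q))
        rw [Seminorm.coe_sup]
        exact hp.sup hq)
      fun i _ => (schwartz_withSeminorms ℝ E' F').continuous_seminorm i
  obtain ⟨s', C, -, h⟩ := Seminorm.bound_of_continuous (schwartz_withSeminorms ℝ E F)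
    ((s.sup (schwartzSeminormFamily ℝ E' F')).comp A.toLinearMap) (hc.comp A.continuous)
  exact ⟨s', C, C.2, fun f => h f⟩

theorem seminorm_smul_sliceSchwartz_le (G : 𝓢(Phase d, V)) (k a b : ℕ) (x : Config d) :
    SchwartzMap.seminorm ℝ a b (‖x‖ ^ k • sliceSchwartz G x) ≤
      SchwartzMap.seminorm ℝ (a + k) b G := by
  rw [map_smul_eq_mul, norm_pow, norm_norm]
  have h0 : 0 ≤ SchwartzMap.seminorm ℝ (a + k) b G := apply_nonneg _ _
  rcases (norm_nonneg x).eq_or_lt with hx | hx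
  · rcases Nat.eq_zero_or_pos k with rfl | hk
    · rw [pow_zero, one_mul, add_zero]
      refine SchwartzMap.seminorm_le_bound _ _ _ _ (apply_nonneg _ _) fun t => ?_
      refine le_trans ?_ (SchwartzMap.le_seminorm ℝ a b G (x, t))
      have h1 : ‖t‖ ≤ ‖(x, t)‖ := norm_snd_le (x, t)
      gcongr
      exact norm_iteratedFDeriv_slice_le G b x t
    · rw [← hx, zero_pow hk.ne', zero_mul]
      exact h0
  · rw [← le_div_iff₀' (by positivity)]
    refine SchwartzMap.seminorm_le_bound _ _ _ _ (by positivity) fun t => ?_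
    rw [le_div_iff₀' (by positivity)]
    refine le_trans ?_ (SchwartzMap.le_seminorm ℝ (a + k) b G (x, t))
    have h1 : ‖t‖ ≤ ‖(x, t)‖ := norm_snd_le (x, t)
    have h2 : ‖x‖ ≤ ‖(x, t)‖ := norm_fst_le (x, t)
    rw [pow_add, ← mul_assoc, mul_comm (‖x‖ ^ k)]
    gcongr
    exact norm_iteratedFDeriv_slice_le G b x t

theorem exists_norm_partialFourier_le (k l : ℕ) :
    ∃ (s : Finset (ℕ × ℕ)) (C : ℝ), 0 ≤ C ∧ ∀ (G : 𝓢(Phase d, V)) (z : Phase d),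
      ‖z.1‖ ^ k * (‖z.2‖ ^ l * ‖partialFourier G z‖) ≤
        C * s.sup (schwartzSeminormFamily ℝ (Phase d) V) G := by
  let A : 𝓢(Config d, V) →L[ℝ] 𝓢(Config d, V) := SchwartzMap.fourierTransformCLM ℝ
  obtain ⟨s, C, hC, h⟩ := exists_sup_seminorm_map_le A {(l, 0)}
  refine ⟨s.image fun i => (i.1 + k, i.2), C, hC, fun G z => ?_⟩
  have h1 : SchwartzMap.seminorm ℝ l 0 (A (‖z.1‖ ^ k • sliceSchwartz G z.1)) ≤
      C * s.sup (schwartzSeminormFamily ℝ (Config d) V) (‖z.1‖ ^ k • sliceSchwartz G z.1) := by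
    have h1 := h (‖z.1‖ ^ k • sliceSchwartz G z.1)
    rwa [Finset.sup_singleton] at h1
  have h2 := SchwartzMap.norm_pow_mul_le_seminorm ℝ (A (‖z.1‖ ^ k • sliceSchwartz G z.1)) l z.2
  have h4 : ‖z.1‖ ^ k * (‖z.2‖ ^ l * ‖partialFourier G z‖) =
      ‖z.2‖ ^ l * ‖A (‖z.1‖ ^ k • sliceSchwartz G z.1) z.2‖ := by
    have h5 : A (sliceSchwartz G z.1) z.2 = partialFourier G z := rfl
    rw [map_smul, smul_apply, norm_smul, norm_pow, norm_norm, h5]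
    ring
  rw [h4]
  refine h2.trans (h1.trans (mul_le_mul_of_nonneg_left ?_ hC))
  refine Seminorm.finset_sup_apply_le (apply_nonneg _ _) fun i hi => ?_
  refine (seminorm_smul_sliceSchwartz_le G k i.1 i.2 z.1).trans ?_
  have hi' : (i.1 + k, i.2) ∈ s.image fun i => (i.1 + k, i.2) := Finset.mem_image_of_mem _ hi
  exact Finset.le_sup (f := schwartzSeminormFamily ℝ (Phase d) V) hi' G

/-- The map `G ↦ partialFourierDeriv G`, whose partial Fourier transform is the derivative of that
of `G`, as a continuous linear map. -/
def partialFourierDerivCLM : 𝓢(Phase d, V) →L[ℝ] 𝓢(Phase d, Phase d →L[ℝ] V) :=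
  SchwartzMap.postcompCLM (𝕜 := ℝ)
      ((ContinuousLinearMap.compL ℝ (Phase d) (Phase d) V).flip
        ((ContinuousLinearMap.inl ℝ (Config d) (Config d)).comp
          (ContinuousLinearMap.fst ℝ (Config d) (Config d)))) ∘L
      (SchwartzMap.fderivCLM ℝ (Phase d) V) +
    (-(2 * Real.pi * Complex.I)) •
      SchwartzMap.bilinLeftCLM (𝕜 := ℝ) (ContinuousLinearMap.smulRightL ℝ (Phase d) V).flip
        (g := fun z : Phase d => (innerSL ℝ z.2).comp
          (ContinuousLinearMap.snd ℝ (Config d) (Config d)))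
        (((((ContinuousLinearMap.compL ℝ (Phase d) (Config d) ℝ).flip
          (ContinuousLinearMap.snd ℝ (Config d) (Config d))).comp (innerSL ℝ)).comp
          (ContinuousLinearMap.snd ℝ (Config d) (Config d))).hasTemperateGrowth)

/-- The derivatives of a partial Fourier transform are again partial Fourier transforms, of functions
with values in a larger space; hence the induction over all target spaces. -/
theorem exists_norm_iteratedFDeriv_partialFourier_le {d : ℕ} (n : ℕ) :
    ∀ {V : Type} [NormedAddCommGroup V] [NormedSpace ℂ V] (k : ℕ),
    ∃ (s : Finset (ℕ × ℕ)) (C : ℝ), 0 ≤ C ∧ ∀ (G : 𝓢(Phase d, V)) (z : Phase d),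
      ‖z‖ ^ k * ‖iteratedFDeriv ℝ n (partialFourier G) z‖ ≤
        C * s.sup (schwartzSeminormFamily ℝ (Phase d) V) G := by
  induction n with
  | zero =>
    intro V _ _ k
    obtain ⟨s₁, C₁, hC₁, h₁⟩ := exists_norm_partialFourier_le (d := d) (V := V) k 0
    obtain ⟨s₂, C₂, hC₂, h₂⟩ := exists_norm_partialFourier_le (d := d) (V := V) 0 k
    refine ⟨s₁ ∪ s₂, C₁ + C₂, by positivity, fun G z => ?_⟩
    have hz : ‖z‖ ^ k ≤ ‖z.1‖ ^ k + ‖z.2‖ ^ k := by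
      rw [Prod.norm_def]
      rcases max_cases ‖z.1‖ ‖z.2‖ with h | h <;> rw [h.1]
      · exact le_add_of_nonneg_right (by positivity)
      · exact le_add_of_nonneg_left (by positivity)
    have b₁ := h₁ G z
    have b₂ := h₂ G z
    simp only [pow_zero, one_mul] at b₁ b₂
    have c₁ : s₁.sup (schwartzSeminormFamily ℝ (Phase d) V) G ≤
        (s₁ ∪ s₂).sup (schwartzSeminormFamily ℝ (Phase d) V) G :=
      Finset.sup_mono (f := schwartzSeminormFamily ℝ (Phase d) V) Finset.subset_union_left G
    have c₂ : s₂.sup (schwartzSeminormFamily ℝ (Phase d) V) G ≤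
        (s₁ ∪ s₂).sup (schwartzSeminormFamily ℝ (Phase d) V) G :=
      Finset.sup_mono (f := schwartzSeminormFamily ℝ (Phase d) V) Finset.subset_union_right G
    rw [norm_iteratedFDeriv_zero]
    calc _ ≤ (‖z.1‖ ^ k + ‖z.2‖ ^ k) * ‖partialFourier G z‖ := by gcongr
      _ = ‖z.1‖ ^ k * ‖partialFourier G z‖ + ‖z.2‖ ^ k * ‖partialFourier G z‖ := by ring
      _ ≤ C₁ * (s₁ ∪ s₂).sup (schwartzSeminormFamily ℝ (Phase d) V) G +
          C₂ * (s₁ ∪ s₂).sup (schwartzSeminormFamily ℝ (Phase d) V) G :=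
        add_le_add (b₁.trans (by gcongr)) (b₂.trans (by gcongr))
      _ = _ := by ring
  | succ n ih =>
    intro V _ _ k
    obtain ⟨s, C, hC, h⟩ := ih (V := Phase d →L[ℝ] V) k
    obtain ⟨s', C', hC', h'⟩ := exists_sup_seminorm_map_le
      (partialFourierDerivCLM : 𝓢(Phase d, V) →L[ℝ] 𝓢(Phase d, Phase d →L[ℝ] V)) s
    refine ⟨s', C * C', by positivity, fun G z => ?_⟩
    rw [← norm_iteratedFDeriv_fderiv, fderiv_partialFourier, mul_assoc]
    refine (h _ z).trans ?_
    gcongr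
    exact h' G

/-- The partial Fourier transform as a continuous linear map on Schwartz functions. -/
def partialFourierCLM (d : ℕ) : 𝓢(Phase d, ℂ) →L[ℝ] 𝓢(Phase d, ℂ) :=
  SchwartzMap.mkCLM (σ := RingHom.id ℝ) (fun G => partialFourier G)
    (fun G H z => by
      change 𝓕 (sliceSchwartz (G + H) z.1) z.2 =
        𝓕 (sliceSchwartz G z.1) z.2 + 𝓕 (sliceSchwartz H z.1) z.2
      have h : sliceSchwartz (G + H) z.1 = sliceSchwartz G z.1 + sliceSchwartz H z.1 := rfl
      rw [h, FourierTransform.fourier_add, add_apply])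
    (fun c G z => by
      change 𝓕 (sliceSchwartz (c • G) z.1) z.2 = c • 𝓕 (sliceSchwartz G z.1) z.2
      have h : sliceSchwartz (c • G) z.1 = c • sliceSchwartz G z.1 := rfl
      rw [h, FourierTransform.fourier_smul, smul_apply])
    (fun G => contDiff_infty.2 fun n => partialFourier_contDiff_nat n G)
    (fun n => exists_norm_iteratedFDeriv_partialFourier_le n.2 n.1)

/-- Fourier inversion on every slice: the partial Fourier transform is onto. -/
theorem surjective_partialFourierCLM (d : ℕ) : Function.Surjective (partialFourierCLM d) := by
  intro g
  let A : 𝓢(Phase d, ℂ) →L[ℝ] 𝓢(Phase d, ℂ) := SchwartzMap.compCLMOfContinuousLinearEquiv ℝ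
    ((ContinuousLinearEquiv.refl ℝ (Config d)).prodCongr (ContinuousLinearEquiv.neg ℝ))
  refine ⟨A (partialFourierCLM d g), SchwartzMap.ext fun z => ?_⟩
  have h1 : sliceSchwartz (A (partialFourierCLM d g)) z.1 = 𝓕⁻ (sliceSchwartz g z.1) := by
    ext t
    rw [SchwartzMap.fourierInv_coe, Real.fourierInv_eq_fourier_neg]
    rfl
  change 𝓕 (sliceSchwartz (A (partialFourierCLM d g)) z.1) z.2 = sliceSchwartz g z.1 z.2
  rw [h1, FourierTransform.fourier_fourierInv_eq]

end PartialFourierCLM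

/-! ### Density of tensor products in `L²` of phase space -/

section TensorDense

variable {d : ℕ}

@[simp]
theorem tensorSchwartz_apply {E F : Type} [NormedAddCommGroup E] [NormedSpace ℝ E]
    [NormedAddCommGroup F] [NormedSpace ℝ F] (f : 𝓢(E, ℂ)) (g : 𝓢(F, ℂ)) (z : E × F) :
    tensorSchwartz f g z = f z.1 * g z.2 := rfl

theorem memLp_tensor {f g : Config d → ℂ} (hf : MemLp f 2 volume) (hg : MemLp g 2 volume) :
    MemLp (fun z : Phase d => f z.1 * g z.2) 2 volume := by
  have hm : AEStronglyMeasurable (fun z : Phase d => f z.1 * g z.2) volume :=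
    hf.1.comp_fst.mul hg.1.comp_snd
  refine (memLp_two_iff_integrable_sq_norm hm).2 ?_
  have h := ((memLp_two_iff_integrable_sq_norm hf.1).1 hf).mul_prod
    ((memLp_two_iff_integrable_sq_norm hg.1).1 hg)
  simp only [norm_mul, mul_pow]
  exact h

theorem memLp_indicator_one {A : Set (Config d)} (hA : MeasurableSet A) (hA' : volume A ≠ ⊤) :
    MemLp (A.indicator fun _ => (1 : ℂ)) 2 volume :=
  memLp_indicator_const 2 hA 1 (Or.inr hA')

theorem ae_eq_zero_of_integral_schwartz_mul {g : Config d → ℂ} (hg : LocallyIntegrable g volume)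
    (h : ∀ ψ : 𝓢(Config d, ℂ), ∫ x, ψ x * g x = 0) : g =ᵐ[volume] 0 := by
  refine ae_eq_zero_of_integral_contDiff_smul_eq_zero hg fun χ hχ hc => ?_
  have hc' : HasCompactSupport (fun x => (χ x : ℂ)) := hc.comp_left (g := fun r : ℝ => (r : ℂ)) rfl
  have hs : ContDiff ℝ ∞ (fun x => (χ x : ℂ)) := Complex.ofRealCLM.contDiff.comp hχ
  have h1 := h (hc'.toSchwartzMap hs)
  refine Eq.trans (integral_congr_ae (Filter.Eventually.of_forall fun x => ?_)) h1
  change (χ x) • g x = (χ x : ℂ) * g x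
  rw [Complex.real_smul]

/-- This lemma exchanges Schwartz factors for indicator functions, one variable at a time, in the
passage from tensor products to rectangles. -/
theorem ae_integral_mul_eq_zero_of_tensor {f : Config d → ℂ} (hf : MemLp f 2 volume)
    {h : Phase d → ℂ} (hh : MemLp h 2 volume)
    (h0 : ∀ ξ : 𝓢(Config d, ℂ), ∫ z : Phase d, f z.1 * ξ z.2 * h z = 0) :
    (fun y => ∫ x, f x * h (x, y)) =ᵐ[volume] 0 := by
  have hint : ∀ {g : Config d → ℂ}, MemLp g 2 volume →
      Integrable (fun z : Phase d => f z.1 * g z.2 * h z) volume := fun hg =>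
    (memLp_tensor hf hg).integrable_mul hh
  refine ae_eq_zero_of_integral_schwartz_mul ?_ fun ξ => ?_
  · refine (locallyIntegrable_iff).2 fun K hK => ?_
    have h1 := (hint (memLp_indicator_one hK.measurableSet hK.measure_lt_top.ne)).swap
    have h2 := h1.integral_prod_left
    refine (integrable_indicator_iff hK.measurableSet).1 ?_
    refine h2.congr (Filter.Eventually.of_forall fun y => ?_)
    by_cases hy : y ∈ K <;> simp [hy]
  · have h1 := h0 ξ
    rw [Measure.volume_eq_prod, integral_prod_symm _ (hint (ξ.memLp 2 volume))] at h1
    rw [← h1]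
    refine integral_congr_ae (Filter.Eventually.of_forall fun y => ?_)
    simp only
    rw [← integral_const_mul]
    refine integral_congr_ae (Filter.Eventually.of_forall fun x => ?_)
    simp only
    ring

theorem ae_eq_zero_of_integral_tensor {h : Phase d → ℂ} (hh : MemLp h 2 volume)
    (h0 : ∀ ψ ξ : 𝓢(Config d, ℂ), ∫ z : Phase d, ψ z.1 * ξ z.2 * h z = 0) :
    h =ᵐ[volume] 0 := by
  have hsw : MeasurePreserving (Prod.swap : Phase d → Phase d) volume volume :=
    Measure.measurePreserving_swap
  have hh' : MemLp (fun z : Phase d => h z.swap) 2 volume := hh.comp_measurePreserving hsw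
  -- The integrals over all rectangles with sides of finite measure vanish.
  have hrect : ∀ A B : Set (Config d), MeasurableSet A → MeasurableSet B → volume A ≠ ⊤ →
      volume B ≠ ⊤ → ∫ z in A ×ˢ B, h z = 0 := by
    intro A B hA hB hA' hB'
    have mA := memLp_indicator_one hA hA'
    have mB := memLp_indicator_one hB hB'
    have h1 : ∀ ξ : 𝓢(Config d, ℂ),
        ∫ z : Phase d, (A.indicator fun _ => (1 : ℂ)) z.1 * ξ z.2 * h z = 0 := by
      intro ξ
      have h2 := ae_integral_mul_eq_zero_of_tensor (f := ξ) (ξ.memLp 2 volume) hh' (fun ψ => by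
        rw [← h0 ψ ξ, ← hsw.integral_comp MeasurableEquiv.prodComm.measurableEmbedding]
        refine integral_congr_ae (Filter.Eventually.of_forall fun z => ?_)
        simp only [Prod.fst_swap, Prod.snd_swap, Prod.swap_swap]
        ring)
      have h3 : Integrable (fun z : Phase d =>
          (A.indicator fun _ => (1 : ℂ)) z.1 * ξ z.2 * h z) volume :=
        (memLp_tensor mA (ξ.memLp 2 volume)).integrable_mul hh
      rw [Measure.volume_eq_prod, integral_prod _ h3]
      refine integral_eq_zero_of_ae (h2.mono fun x hx => ?_)
      simp only [Pi.zero_apply, Prod.swap_prod_mk] at hx ⊢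
      simp only [mul_assoc]
      rw [integral_const_mul, hx, mul_zero]
    have h3 := ae_integral_mul_eq_zero_of_tensor mA hh h1
    have h4 : Integrable (fun z : Phase d => (A.indicator fun _ => (1 : ℂ)) z.1 *
        (B.indicator fun _ => (1 : ℂ)) z.2 * h z) volume :=
      (memLp_tensor mA mB).integrable_mul hh
    have h5 : ∫ z : Phase d, (A.indicator fun _ => (1 : ℂ)) z.1 *
        (B.indicator fun _ => (1 : ℂ)) z.2 * h z = 0 := by
      rw [Measure.volume_eq_prod, integral_prod_symm _ h4]
      refine integral_eq_zero_of_ae (h3.mono fun y hy => ?_)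
      simp only [Pi.zero_apply] at hy ⊢
      have h6 : ∀ x, (A.indicator fun _ => (1 : ℂ)) x * (B.indicator fun _ => (1 : ℂ)) y * h (x, y) =
          (B.indicator fun _ => (1 : ℂ)) y * ((A.indicator fun _ => (1 : ℂ)) x * h (x, y)) :=
        fun x => by ring
      simp only [h6]
      rw [integral_const_mul, hy, mul_zero]
    rw [← integral_indicator (hA.prod hB), ← h5]
    refine integral_congr_ae (Filter.Eventually.of_forall fun z => ?_)
    by_cases hz1 : z.1 ∈ A <;> by_cases hz2 : z.2 ∈ B <;> simp [Set.indicator, Set.mem_prod, hz1, hz2]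
  -- A π-λ argument inside the bounded rectangles `R n` which exhaust phase space.
  let K : ℕ → Set (Config d) := fun n => Metric.closedBall 0 n
  have hKm : ∀ n, MeasurableSet (K n) := fun n => Metric.isClosed_closedBall.measurableSet
  have hKf : ∀ n, volume (K n) < ⊤ := fun n => measure_closedBall_lt_top
  let R : ℕ → Set (Phase d) := fun n => K n ×ˢ K n
  have hRm : ∀ n, MeasurableSet (R n) := fun n => (hKm n).prod (hKm n)
  have hRf : ∀ n, volume (R n) < ⊤ := fun n => by
    rw [Measure.volume_eq_prod, Measure.prod_prod]
    exact ENNReal.mul_lt_top (hKf n) (hKf n)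
  have hR : ∀ n, ∀ᵐ z ∂(volume.restrict (R n)), h z = 0 := by
    intro n
    have : IsFiniteMeasure (volume.restrict (R n)) := ⟨by
      rw [Measure.restrict_apply_univ]; exact hRf n⟩
    have hi : Integrable h (volume.restrict (R n)) :=
      (hh.mono_measure Measure.restrict_le_self).integrable (by norm_num)
    have hz : ∫ z in R n, h z = 0 := hrect _ _ (hKm n) (hKm n) (hKf n).ne (hKf n).ne
    have hs : ∀ s, MeasurableSet s → ∫ z in s, h z ∂(volume.restrict (R n)) = 0 := by
      intro s hs
      induction s, hs using MeasurableSpace.induction_on_inter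
        (generateFrom_prod (α := Config d) (β := Config d)).symm isPiSystem_prod with
      | empty => simp
      | basic t ht =>
        obtain ⟨A, hA, B, hB, rfl⟩ := ht
        rw [Set.mem_ofPred_eq] at hA hB
        rw [Measure.restrict_restrict (hA.prod hB), Set.prod_inter_prod]
        exact hrect _ _ (hA.inter (hKm n)) (hB.inter (hKm n))
          (measure_lt_top_of_subset Set.inter_subset_right (hKf n).ne).ne
          (measure_lt_top_of_subset Set.inter_subset_right (hKf n).ne).ne
      | compl t ht ih =>
        have h1 := integral_add_compl ht hi
        rwa [ih, zero_add, hz] at h1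
      | iUnion t hd ht ih =>
        have h1 := hasSum_integral_iUnion ht hd hi.integrableOn
        simp only [ih] at h1
        exact h1.unique hasSum_zero
    exact hi.ae_eq_zero_of_forall_setIntegral_eq_zero fun s hs' _ => hs s hs'
  have hU : (⋃ n, R n) = Set.univ := by
    refine Set.eq_univ_of_forall fun z => Set.mem_iUnion.2 ?_
    obtain ⟨n, hn⟩ := exists_nat_ge ‖z‖
    refine ⟨n, ?_, ?_⟩
    · exact mem_closedBall_zero_iff.2 ((norm_fst_le z).trans hn)
    · exact mem_closedBall_zero_iff.2 ((norm_snd_le z).trans hn)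
  have h1 := (ae_restrict_iUnion_iff R (fun z => h z = 0)).2 hR
  rwa [hU, Measure.restrict_univ] at h1

/-- The linear span of the tensor products of Schwartz functions. -/
def tensorSpan (d : ℕ) : Submodule ℂ 𝓢(Phase d, ℂ) :=
  Submodule.span ℂ {G | ∃ ψ ξ : 𝓢(Config d, ℂ), tensorSchwartz ψ ξ = G}

theorem topologicalClosure_map_tensorSpan (d : ℕ) :
    ((tensorSpan d).map (SchwartzMap.toLpCLM ℂ ℂ 2 (volume : Measure (Phase d))).toLinearMap
      ).topologicalClosure = ⊤ := by
  rw [Submodule.topologicalClosure_eq_top_iff, Submodule.eq_bot_iff]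
  intro h hh
  have h0 : ∀ ψ ξ : 𝓢(Config d, ℂ), ∫ z : Phase d, ψ z.1 * ξ z.2 * h z = 0 := by
    intro ψ ξ
    have hm : (tensorSchwartz (conjSchwartz ψ) (conjSchwartz ξ)).toLp 2 volume ∈
        (tensorSpan d).map (SchwartzMap.toLpCLM ℂ ℂ 2 (volume : Measure (Phase d))).toLinearMap :=
      Submodule.mem_map_of_mem (Submodule.subset_span ⟨_, _, rfl⟩)
    have h1 := (Submodule.mem_orthogonal _ _).1 hh _ hm
    rw [L2.inner_def] at h1
    refine Eq.trans (integral_congr_ae ?_) h1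
    filter_upwards [(tensorSchwartz (conjSchwartz ψ) (conjSchwartz ξ)).coeFn_toLp 2 volume] with z hz
    rw [hz, RCLike.inner_apply']
    simp
  exact (Lp.eq_zero_iff_ae_eq_zero).2 (ae_eq_zero_of_integral_tensor (Lp.memLp h) h0)

end TensorDense

/-! ### The Fourier transform on phase space -/

section PhaseFourier

variable {d : ℕ}

/-- The Euclidean pairing of phase space with itself, `⟨(x, y), (ξ, η)⟩ = x · ξ + y · η`. -/
def phaseForm (d : ℕ) : Phase d →L[ℝ] Phase d →L[ℝ] ℝ :=
  (innerSL ℝ).bilinearComp (ContinuousLinearMap.fst ℝ (Config d) (Config d))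
      (ContinuousLinearMap.fst ℝ (Config d) (Config d)) +
    (innerSL ℝ).bilinearComp (ContinuousLinearMap.snd ℝ (Config d) (Config d))
      (ContinuousLinearMap.snd ℝ (Config d) (Config d))

theorem phaseForm_apply (z w : Phase d) :
    phaseForm d z w = ⟪z.1, w.1⟫_ℝ + ⟪z.2, w.2⟫_ℝ := rfl

/-- The exchange of the two variables of a Schwartz function on phase space. -/
def swapCLM (d : ℕ) : 𝓢(Phase d, ℂ) →L[ℝ] 𝓢(Phase d, ℂ) :=
  SchwartzMap.compCLMOfContinuousLinearEquiv ℝ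
    (ContinuousLinearEquiv.prodComm ℝ (Config d) (Config d))

theorem swapCLM_apply (G : 𝓢(Phase d, ℂ)) (z : Phase d) : swapCLM d G z = G (z.2, z.1) := rfl

/-- The Fourier transform in both variables, as the composition of the two partial ones. -/
def phaseFourier (d : ℕ) : 𝓢(Phase d, ℂ) →L[ℝ] 𝓢(Phase d, ℂ) :=
  ((partialFourierCLM d ∘L swapCLM d) ∘L partialFourierCLM d) ∘L swapCLM d

theorem surjective_phaseFourier (d : ℕ) : Function.Surjective (phaseFourier d) := by
  have hs : Function.Surjective (swapCLM d) := fun G => ⟨swapCLM d G, rfl⟩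
  exact (((surjective_partialFourierCLM d).comp hs).comp (surjective_partialFourierCLM d)).comp hs

theorem phaseFourier_eq (G : 𝓢(Phase d, ℂ)) : (phaseFourier d G : Phase d → ℂ) =
    VectorFourier.fourierIntegral Real.fourierChar volume (phaseForm d).toLinearMap₁₂ G := by
  funext w
  have h1 : phaseFourier d G w = ∫ y, Real.fourierChar (-⟪y, w.2⟫_ℝ) •
      ∫ x, Real.fourierChar (-⟪x, w.1⟫_ℝ) • G (x, y) := rfl
  rw [h1]
  change _ = ∫ z, Real.fourierChar (-(phaseForm d z w)) • G z
  have hc : Continuous fun z : Phase d => Real.fourierChar (-(phaseForm d z w)) :=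
    Real.continuous_fourierChar.comp (by fun_prop)
  have hi : Integrable (fun z : Phase d => Real.fourierChar (-(phaseForm d z w)) • G z) := by
    refine (G.integrable (μ := volume)).norm.mono' (hc.smul G.continuous).aestronglyMeasurable ?_
    exact Filter.Eventually.of_forall fun z => (Circle.norm_smul _ _).le
  rw [Measure.volume_eq_prod] at hi ⊢
  rw [integral_prod_symm _ hi]
  refine integral_congr_ae (Filter.Eventually.of_forall fun y => ?_)
  simp only [Circle.smul_def, smul_eq_mul]
  rw [← integral_const_mul]
  refine integral_congr_ae (Filter.Eventually.of_forall fun x => ?_)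
  simp only [phaseForm_apply, neg_add, AddChar.map_add_eq_mul, Circle.coe_mul]
  ring

theorem norm_iteratedFDeriv_phaseFourier_le (G : 𝓢(Phase d, ℂ)) (n : ℕ) (w : Phase d) :
    ‖iteratedFDeriv ℝ n (phaseFourier d G) w‖ ≤
      (2 * Real.pi * ‖phaseForm d‖) ^ n * ∫ z, ‖z‖ ^ n * ‖G z‖ := by
  have hi : ∀ k : ℕ, Integrable (fun z => ‖z‖ ^ k * ‖G z‖) := fun k => G.integrable_pow_mul volume k
  rw [phaseFourier_eq, VectorFourier.iteratedFDeriv_fourierIntegral (phaseForm d) (N := ⊤)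
    (fun k _ => hi k) G.continuous.aestronglyMeasurable le_top]
  refine (VectorFourier.norm_fourierIntegral_le_integral_norm _ _ _ _ _).trans ?_
  rw [← integral_const_mul]
  refine integral_mono_of_nonneg (Filter.Eventually.of_forall fun z => norm_nonneg _)
    ((hi n).const_mul _) (Filter.Eventually.of_forall fun z => ?_)
  refine (VectorFourier.norm_fourierPowSMulRight_le (phaseForm d) G z n).trans (le_of_eq ?_)
  ring

theorem integral_norm_mul_norm_le {α : Type*} [MeasurableSpace α] {μ : Measure α} {f g : α → ℂ}
    (hf : MemLp f 2 μ) (hg : MemLp g 2 μ) :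
    ∫ z, ‖f z‖ * ‖g z‖ ∂μ ≤ (eLpNorm f 2 μ).toReal * (eLpNorm g 2 μ).toReal := by
  have h := integral_mul_norm_le_Lp_mul_Lq (μ := μ) (p := 2) (q := 2) (f := f) (g := g)
    (by constructor <;> norm_num) (by simpa using hf) (by simpa using hg)
  rw [hf.eLpNorm_eq_integral_rpow_norm (by norm_num) (by norm_num),
    hg.eLpNorm_eq_integral_rpow_norm (by norm_num) (by norm_num),
    ENNReal.toReal_ofReal (by positivity), ENNReal.toReal_ofReal (by positivity)]
  simpa using h

theorem memLp_norm_pow_mul (Y : 𝓢(Phase d, ℂ)) (n : ℕ) :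
    MemLp (fun z : Phase d => ((‖z‖ ^ n : ℝ) : ℂ) * Y z) 2 volume := by
  have hm : AEStronglyMeasurable (fun z : Phase d => ((‖z‖ ^ n : ℝ) : ℂ) * Y z) volume :=
    ((Complex.continuous_ofReal.comp (continuous_norm.pow n)).mul
      Y.continuous).aestronglyMeasurable
  refine (memLp_two_iff_integrable_sq_norm hm).2 ?_
  obtain ⟨C, -, hC⟩ := Y.decay n 0
  refine ((Y.integrable_pow_mul volume n).const_mul C).mono' (hm.norm.pow 2)
    (Filter.Eventually.of_forall fun z => ?_)
  have h := hC z
  rw [norm_iteratedFDeriv_zero] at h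
  rw [norm_pow, norm_norm, norm_mul, Complex.norm_real, norm_pow, norm_norm, sq]
  gcongr

/-! ### Regularisation of Schwartz functions -/

/-- Multiplication by a Schwartz function. -/
def mulSchwartz {E : Type} [NormedAddCommGroup E] [NormedSpace ℝ E] (X : 𝓢(E, ℂ)) :
    𝓢(E, ℂ) →L[ℝ] 𝓢(E, ℂ) :=
  (SchwartzMap.smulLeftCLM ℂ (X : E → ℂ)).restrictScalars ℝ

@[simp]
theorem mulSchwartz_apply {E : Type} [NormedAddCommGroup E] [NormedSpace ℝ E] (X g : 𝓢(E, ℂ))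
    (z : E) : mulSchwartz X g z = X z * g z :=
  SchwartzMap.smulLeftCLM_apply_apply X.hasTemperateGrowth g z

/-- The regularisation `g ↦ X · 𝓕 (Y · g)`, which maps `L²` continuously into the Schwartz
functions. -/
def regularize (X Y : 𝓢(Phase d, ℂ)) : 𝓢(Phase d, ℂ) →L[ℝ] 𝓢(Phase d, ℂ) :=
  (mulSchwartz X ∘L phaseFourier d) ∘L mulSchwartz Y

theorem exists_norm_iteratedFDeriv_phaseFourier_mul_le (Y : 𝓢(Phase d, ℂ)) (n : ℕ) :
    ∃ C : ℝ, 0 ≤ C ∧ ∀ (g : 𝓢(Phase d, ℂ)) (z : Phase d),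
      ‖iteratedFDeriv ℝ n (phaseFourier d (mulSchwartz Y g)) z‖ ≤ C * ‖g.toLp 2 volume‖ := by
  refine ⟨(2 * Real.pi * ‖phaseForm d‖) ^ n *
    (eLpNorm (fun z : Phase d => ((‖z‖ ^ n : ℝ) : ℂ) * Y z) 2 volume).toReal, by positivity,
    fun g z => ?_⟩
  refine (norm_iteratedFDeriv_phaseFourier_le _ n z).trans ?_
  rw [SchwartzMap.norm_toLp]
  refine (mul_le_mul_of_nonneg_left ?_ (by positivity)).trans_eq (mul_assoc _ _ _).symm
  refine le_trans (le_of_eq ?_)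
    (integral_norm_mul_norm_le (memLp_norm_pow_mul Y n) (g.memLp 2 volume))
  refine integral_congr_ae (Filter.Eventually.of_forall fun z => ?_)
  simp only [mulSchwartz_apply, norm_mul, Complex.norm_real, norm_pow, norm_norm]
  ring

theorem exists_seminorm_regularize_le (X Y : 𝓢(Phase d, ℂ)) (k n : ℕ) :
    ∃ C : ℝ, 0 ≤ C ∧ ∀ g : 𝓢(Phase d, ℂ),
      SchwartzMap.seminorm ℝ k n (regularize X Y g) ≤ C * ‖g.toLp 2 volume‖ := by
  choose C hC0 hC using exists_norm_iteratedFDeriv_phaseFourier_mul_le Y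
  refine ⟨∑ i ∈ Finset.range (n + 1), (n.choose i : ℝ) * SchwartzMap.seminorm ℝ k i X * C (n - i),
    Finset.sum_nonneg fun i _ => mul_nonneg (mul_nonneg (by positivity) (apply_nonneg _ _)) (hC0 _),
    fun g => ?_⟩
  refine SchwartzMap.seminorm_le_bound _ _ _ _ (mul_nonneg (Finset.sum_nonneg fun i _ =>
    mul_nonneg (mul_nonneg (by positivity) (apply_nonneg _ _)) (hC0 _)) (norm_nonneg _))
    fun z => ?_
  have h1 : (regularize X Y g : Phase d → ℂ) =
      fun z => X z * phaseFourier d (mulSchwartz Y g) z := by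
    funext z
    exact mulSchwartz_apply X _ z
  rw [h1, Finset.sum_mul]
  refine (mul_le_mul_of_nonneg_left (norm_iteratedFDeriv_mul_le (X.smooth ⊤)
    ((phaseFourier d (mulSchwartz Y g)).smooth ⊤) z (n := n) (mod_cast le_top))
    (by positivity)).trans ?_
  rw [Finset.mul_sum]
  refine Finset.sum_le_sum fun i _ => ?_
  have h2 := SchwartzMap.le_seminorm ℝ k i X z
  have h3 := hC (n - i) g z
  calc _ = (n.choose i : ℝ) * (‖z‖ ^ k * ‖iteratedFDeriv ℝ i X z‖) *
        ‖iteratedFDeriv ℝ (n - i) (phaseFourier d (mulSchwartz Y g)) z‖ := by ring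
    _ ≤ (n.choose i : ℝ) * SchwartzMap.seminorm ℝ k i X * (C (n - i) * ‖g.toLp 2 volume‖) := by
      gcongr
    _ = _ := by ring

theorem exists_norm_regularize_le (v : 𝓢(Phase d, ℂ) →L[ℝ] ℂ) (X Y : 𝓢(Phase d, ℂ)) :
    ∃ C : ℝ, 0 ≤ C ∧ ∀ g : 𝓢(Phase d, ℂ), ‖v (regularize X Y g)‖ ≤ C * ‖g.toLp 2 volume‖ := by
  obtain ⟨s, C, -, h⟩ := Seminorm.bound_of_continuous (schwartz_withSeminorms ℝ (Phase d) ℂ)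
    ((normSeminorm ℝ ℂ).comp v.toLinearMap) (continuous_norm.comp v.continuous)
  choose D hD0 hD using exists_seminorm_regularize_le X Y
  refine ⟨C * ∑ i ∈ s, D i.1 i.2, by
    have := Finset.sum_nonneg fun (i : ℕ × ℕ) (_ : i ∈ s) => hD0 i.1 i.2
    positivity, fun g => ?_⟩
  refine (h (regularize X Y g)).trans ?_
  change (C : ℝ) * (s.sup (schwartzSeminormFamily ℝ (Phase d) ℂ)) (regularize X Y g) ≤ _
  rw [mul_assoc, Finset.sum_mul]
  refine mul_le_mul_of_nonneg_left ?_ C.2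
  refine Seminorm.finset_sup_apply_le
    (Finset.sum_nonneg fun i _ => mul_nonneg (hD0 _ _) (norm_nonneg _)) fun i hi => ?_
  refine (hD i.1 i.2 g).trans ?_
  exact Finset.single_le_sum (f := fun i : ℕ × ℕ => D i.1 i.2 * ‖g.toLp 2 volume‖)
    (fun i _ => mul_nonneg (hD0 _ _) (norm_nonneg _)) hi

theorem regularize_tensorSchwartz (a b a' b' ψ ξ : 𝓢(Config d, ℂ)) :
    regularize (tensorSchwartz a b) (tensorSchwartz a' b') (tensorSchwartz ψ ξ) =
      tensorSchwartz (mulSchwartz a (𝓕 (mulSchwartz a' ψ)))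
        (mulSchwartz b (𝓕 (mulSchwartz b' ξ))) := by
  have h1 : mulSchwartz (tensorSchwartz a' b') (tensorSchwartz ψ ξ) =
      tensorSchwartz (mulSchwartz a' ψ) (mulSchwartz b' ξ) := by
    ext z
    simp only [mulSchwartz_apply, tensorSchwartz_apply]
    ring
  have h2 : ∀ f g : 𝓢(Config d, ℂ), swapCLM d (tensorSchwartz f g) = tensorSchwartz g f := by
    intro f g
    ext z
    rw [swapCLM_apply, tensorSchwartz_apply, tensorSchwartz_apply, mul_comm]
  have h3 : ∀ f g : 𝓢(Config d, ℂ),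
      partialFourierCLM d (tensorSchwartz f g) = tensorSchwartz f (𝓕 g) := by
    intro f g
    ext z
    exact fourier_const_mul (f z.1) g z.2
  have h4 : regularize (tensorSchwartz a b) (tensorSchwartz a' b') (tensorSchwartz ψ ξ) =
      mulSchwartz (tensorSchwartz a b) (partialFourierCLM d (swapCLM d (partialFourierCLM d
        (swapCLM d (mulSchwartz (tensorSchwartz a' b') (tensorSchwartz ψ ξ)))))) := rfl
  rw [h4, h1, h2, h3, h2, h3]
  ext z
  simp only [mulSchwartz_apply, tensorSchwartz_apply]
  ring

/-- A continuous functional which vanishes on tensor products vanishes on all regularised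
functions, because it is continuous for the `L²` norm there. -/
theorem apply_regularize_eq_zero (v : 𝓢(Phase d, ℂ) →L[ℝ] ℂ)
    (hv : ∀ ψ ξ : 𝓢(Config d, ℂ), v (tensorSchwartz ψ ξ) = 0) (a b a' b' : 𝓢(Config d, ℂ))
    (g : 𝓢(Phase d, ℂ)) :
    v (regularize (tensorSchwartz a b) (tensorSchwartz a' b') g) = 0 := by
  obtain ⟨C, hC0, hC⟩ := exists_norm_regularize_le v (tensorSchwartz a b) (tensorSchwartz a' b')
  have hspan : ∀ s ∈ tensorSpan d, ∀ c : ℂ,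
      v (regularize (tensorSchwartz a b) (tensorSchwartz a' b') (c • s)) = 0 := by
    intro s hs
    induction hs using Submodule.span_induction with
    | mem x hx =>
      obtain ⟨ψ, ξ, rfl⟩ := hx
      intro c
      have h1 : c • tensorSchwartz ψ ξ = tensorSchwartz (c • ψ) ξ := by
        ext z
        simp [mul_assoc]
      rw [h1, regularize_tensorSchwartz, hv]
    | zero => intro c; simp
    | add x y _ _ hx hy => intro c; rw [smul_add, map_add, map_add, hx c, hy c, add_zero]
    | smul a x _ hx => intro c; rw [smul_smul]; exact hx _
  have hg : g.toLp 2 volume ∈ ((tensorSpan d).map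
      (SchwartzMap.toLpCLM ℂ ℂ 2 (volume : Measure (Phase d))).toLinearMap).topologicalClosure := by
    rw [topologicalClosure_map_tensorSpan]
    exact Submodule.mem_top
  rw [← SetLike.mem_coe, Submodule.topologicalClosure_coe] at hg
  refine norm_le_zero_iff.1 (le_of_forall_pos_le_add fun ε hε => ?_)
  obtain ⟨_, ⟨s, hs, rfl⟩, hd⟩ := Metric.mem_closure_iff.1 hg (ε / (C + 1)) (by positivity)
  have h1 := hspan s hs 1
  rw [one_smul] at h1
  have h2 := hC (g - s)
  rw [map_sub, map_sub, h1, sub_zero] at h2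
  have h3 : (g - s).toLp 2 volume = g.toLp 2 volume - s.toLp 2 volume := rfl
  have h4 : ‖g.toLp 2 volume - s.toLp 2 volume‖ < ε / (C + 1) := by rwa [← dist_eq_norm]
  rw [h3] at h2
  rw [zero_add]
  calc _ ≤ C * ‖g.toLp 2 volume - s.toLp 2 volume‖ := h2
    _ ≤ (C + 1) * (ε / (C + 1)) := by gcongr; linarith
    _ = ε := by field_simp

end PhaseFourier

/-! ### A tempered distribution is determined by its values on Wigner distributions -/

section Uniqueness

variable {d : ℕ}

/-- The dilation `X(r ·)` of a Schwartz function by a factor `r ≠ 0`. -/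
def dilate {E : Type} [NormedAddCommGroup E] [NormedSpace ℝ E] (r : ℝˣ) (X : 𝓢(E, ℂ)) :
    𝓢(E, ℂ) :=
  SchwartzMap.compCLMOfContinuousLinearEquiv ℝ (ContinuousLinearEquiv.smulLeft r) X

theorem norm_iteratedFDeriv_dilate_le {E : Type} [NormedAddCommGroup E] [NormedSpace ℝ E]
    (r : ℝˣ) (X : 𝓢(E, ℂ)) (i : ℕ) (z : E) :
    ‖iteratedFDeriv ℝ i (dilate r X) z‖ ≤ SchwartzMap.seminorm ℝ 0 i X * |(r : ℝ)| ^ i := by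
  have h := ((r : ℝ) • ContinuousLinearMap.id ℝ E).iteratedFDeriv_comp_right (X.smooth ⊤) z
      (i := i) (mod_cast le_top)
  have h2 : (dilate r X : E → ℂ) = X ∘ ((r : ℝ) • ContinuousLinearMap.id ℝ E) := rfl
  rw [h2, h]
  refine (ContinuousMultilinearMap.norm_compContinuousLinearMap_le _ _).trans ?_
  rw [Finset.prod_const, Finset.card_univ, Fintype.card_fin]
  gcongr
  · exact SchwartzMap.norm_iteratedFDeriv_le_seminorm ℝ X i _
  · rw [norm_smul, Real.norm_eq_abs]
    exact mul_le_of_le_one_right (abs_nonneg _) ContinuousLinearMap.norm_id_le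

theorem norm_dilate_sub_le {E : Type} [NormedAddCommGroup E] [NormedSpace ℝ E]
    (r : ℝˣ) (X : 𝓢(E, ℂ)) (z : E) :
    ‖dilate r X z - X 0‖ ≤ SchwartzMap.seminorm ℝ 0 1 X * (|(r : ℝ)| * ‖z‖) := by
  have h := Convex.norm_image_sub_le_of_norm_fderiv_le (𝕜 := ℝ) (f := X)
    (C := SchwartzMap.seminorm ℝ 0 1 X) (s := Set.univ) (x := 0) (y := (r : ℝ) • z)
    (fun x _ => X.differentiableAt) (fun x _ => by
      rw [← norm_iteratedFDeriv_one]
      exact SchwartzMap.norm_iteratedFDeriv_le_seminorm ℝ X 1 x) convex_univ trivial trivial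
  rwa [sub_zero, norm_smul, Real.norm_eq_abs] at h

/-- The derivatives of `X(r ·) - X(0)` are of size `r (1 + ‖z‖)` as `r → 0`. -/
theorem norm_iteratedFDeriv_dilate_sub_le {E : Type} [NormedAddCommGroup E] [NormedSpace ℝ E]
    (r : ℝˣ) (hr : |(r : ℝ)| ≤ 1) (X : 𝓢(E, ℂ)) (i : ℕ) (z : E) :
    ‖iteratedFDeriv ℝ i (fun z => dilate r X z - X 0) z‖ ≤
      |(r : ℝ)| * (SchwartzMap.seminorm ℝ 0 (max i 1) X * (1 + ‖z‖)) := by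
  have h0 : ∀ n, 0 ≤ SchwartzMap.seminorm ℝ 0 n X := fun n => apply_nonneg _ _
  rcases Nat.eq_zero_or_pos i with rfl | hi
  · rw [norm_iteratedFDeriv_zero]
    refine (norm_dilate_sub_le r X z).trans ?_
    rw [max_eq_right zero_le_one, mul_left_comm]
    gcongr
    linarith
  · have hd : ContDiff ℝ i (dilate r X) := (dilate r X).smooth i
    have h1 : iteratedFDeriv ℝ i (fun z => dilate r X z - X 0) z =
        iteratedFDeriv ℝ i (dilate r X) z := by
      have h2 := iteratedFDeriv_sub_apply (x := z) hd.contDiffAt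
        (contDiff_const (c := X 0)).contDiffAt
      rw [iteratedFDeriv_const_of_ne hi.ne', Pi.zero_apply, sub_zero] at h2
      exact h2
    rw [h1, max_eq_left hi]
    refine (norm_iteratedFDeriv_dilate_le r X i z).trans ?_
    have h2 : |(r : ℝ)| ^ i ≤ |(r : ℝ)| := pow_le_of_le_one (abs_nonneg _) hr hi.ne'
    calc _ ≤ SchwartzMap.seminorm ℝ 0 i X * |(r : ℝ)| := by gcongr
      _ ≤ SchwartzMap.seminorm ℝ 0 i X * |(r : ℝ)| * (1 + ‖z‖) := by
        refine le_mul_of_one_le_right (mul_nonneg (h0 i) (abs_nonneg _)) ?_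
        linarith [norm_nonneg z]
      _ = _ := by ring

/-- Multiplication by the dilations `X(r ·)`, where `X(0) = 1`, is an approximate identity on
Schwartz functions as `r → 0`. -/
theorem tendsto_mulSchwartz_dilate {E : Type} [NormedAddCommGroup E] [NormedSpace ℝ E]
    {X : 𝓢(E, ℂ)} (hX : X 0 = 1) (h : 𝓢(E, ℂ)) (r : ℕ → ℝˣ) (hr1 : ∀ n, |(r n : ℝ)| ≤ 1)
    (hr : Filter.Tendsto (fun n => |(r n : ℝ)|) Filter.atTop (nhds 0)) :
    Filter.Tendsto (fun n => mulSchwartz (dilate (r n) X) h) Filter.atTop (nhds h) := by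
  have key : ∀ k n : ℕ, ∃ C : ℝ, ∀ m,
      SchwartzMap.seminorm ℝ k n (mulSchwartz (dilate (r m) X) h - h) ≤ |(r m : ℝ)| * C := by
    intro k n
    have hnn : 0 ≤ ∑ i ∈ Finset.range (n + 1), (n.choose i : ℝ) *
        SchwartzMap.seminorm ℝ 0 (max i 1) X *
        (SchwartzMap.seminorm ℝ k (n - i) h + SchwartzMap.seminorm ℝ (k + 1) (n - i) h) :=
      Finset.sum_nonneg fun i _ => mul_nonneg (mul_nonneg (by positivity) (apply_nonneg _ _))
        (add_nonneg (apply_nonneg _ _) (apply_nonneg _ _))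
    refine ⟨_, fun m => SchwartzMap.seminorm_le_bound _ _ _ _
      (mul_nonneg (abs_nonneg _) hnn) fun z => ?_⟩
    have h1 : (mulSchwartz (dilate (r m) X) h - h : 𝓢(E, ℂ)) =
        fun z => (dilate (r m) X z - X 0) * h z := by
      funext z
      rw [sub_apply, mulSchwartz_apply, hX]
      ring
    have hs : ContDiff ℝ ∞ (fun z => dilate (r m) X z - X 0) :=
      ((dilate (r m) X).smooth ⊤).sub contDiff_const
    rw [h1, Finset.mul_sum]
    refine (mul_le_mul_of_nonneg_left (norm_iteratedFDeriv_mul_le hs (h.smooth ⊤) z (n := n)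
      (mod_cast le_top)) (by positivity)).trans ?_
    rw [Finset.mul_sum]
    refine Finset.sum_le_sum fun i _ => ?_
    have b1 := norm_iteratedFDeriv_dilate_sub_le (r m) (hr1 m) X i z
    have b2 := SchwartzMap.le_seminorm ℝ k (n - i) h z
    have b3 := SchwartzMap.le_seminorm ℝ (k + 1) (n - i) h z
    have h0 : 0 ≤ SchwartzMap.seminorm ℝ 0 (max i 1) X := apply_nonneg _ _
    calc _ ≤ ‖z‖ ^ k * ((n.choose i : ℝ) *
          (|(r m : ℝ)| * (SchwartzMap.seminorm ℝ 0 (max i 1) X * (1 + ‖z‖))) *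
          ‖iteratedFDeriv ℝ (n - i) h z‖) := by gcongr
      _ = |(r m : ℝ)| * ((n.choose i : ℝ) * SchwartzMap.seminorm ℝ 0 (max i 1) X *
          (‖z‖ ^ k * ‖iteratedFDeriv ℝ (n - i) h z‖ +
            ‖z‖ ^ (k + 1) * ‖iteratedFDeriv ℝ (n - i) h z‖)) := by ring
      _ ≤ _ := by gcongr
  refine ((schwartz_withSeminorms ℝ E ℂ).tendsto_nhds _ h).2 fun ⟨k, n⟩ ε hε => ?_
  obtain ⟨C, hC⟩ := key k n
  have h2 := hr.mul_const C
  rw [zero_mul] at h2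
  filter_upwards [h2.eventually (gt_mem_nhds hε)] with m hm
  exact (hC m).trans_lt hm

theorem exists_schwartz_apply_zero_eq_one (d : ℕ) : ∃ χ : 𝓢(Config d, ℂ), χ 0 = 1 := by
  let b : ContDiffBump (0 : Config d) := ⟨1, 2, one_pos, one_lt_two⟩
  have hc : HasCompactSupport (fun x => (b x : ℂ)) :=
    b.hasCompactSupport.comp_left (g := fun r : ℝ => (r : ℂ)) rfl
  have hs : ContDiff ℝ ∞ (fun x => (b x : ℂ)) := Complex.ofRealCLM.contDiff.comp b.contDiff
  refine ⟨hc.toSchwartzMap hs, ?_⟩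
  change ((b 0 : ℝ) : ℂ) = 1
  rw [b.one_of_mem_closedBall (Metric.mem_closedBall_self b.rIn_pos.le), Complex.ofReal_one]

/-- A continuous functional on `𝓢(ℝ²ᵈ)` which vanishes on tensor products vanishes. -/
theorem eq_zero_of_tensorSchwartz (v : 𝓢(Phase d, ℂ) →L[ℝ] ℂ)
    (hv : ∀ ψ ξ : 𝓢(Config d, ℂ), v (tensorSchwartz ψ ξ) = 0) (g : 𝓢(Phase d, ℂ)) : v g = 0 := by
  obtain ⟨χ, hχ⟩ := exists_schwartz_apply_zero_eq_one d
  let r : ℕ → ℝˣ := fun n => Units.mk0 (1 / ((n : ℝ) + 1)) (by positivity)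
  have hrv : ∀ n, |(r n : ℝ)| = 1 / ((n : ℝ) + 1) := fun n => abs_of_nonneg (by
    change 0 ≤ 1 / ((n : ℝ) + 1)
    positivity)
  have hr1 : ∀ n, |(r n : ℝ)| ≤ 1 := fun n => by
    rw [hrv, div_le_one (by positivity)]
    linarith [Nat.cast_nonneg (α := ℝ) n]
  have hr : Filter.Tendsto (fun n => |(r n : ℝ)|) Filter.atTop (nhds 0) := by
    simp only [hrv]
    exact tendsto_one_div_add_atTop_nhds_zero_nat
  have hX : tensorSchwartz χ χ 0 = 1 := by
    rw [tensorSchwartz_apply, Prod.fst_zero, Prod.snd_zero, hχ, one_mul]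
  have hdil : ∀ n, dilate (r n) (tensorSchwartz χ χ) =
      tensorSchwartz (dilate (r n) χ) (dilate (r n) χ) := fun n => rfl
  have h1 : ∀ (m : ℕ) (g : 𝓢(Phase d, ℂ)),
      v (phaseFourier d (mulSchwartz (dilate (r m) (tensorSchwartz χ χ)) g)) = 0 := by
    intro m g
    have hl := (v.continuous.tendsto _).comp (tendsto_mulSchwartz_dilate hX
      (phaseFourier d (mulSchwartz (dilate (r m) (tensorSchwartz χ χ)) g)) r hr1 hr)
    refine tendsto_nhds_unique hl (tendsto_const_nhds.congr fun n => ?_)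
    rw [Function.comp_apply, hdil, hdil]
    exact (apply_regularize_eq_zero v hv _ _ _ _ g).symm
  have h2 : ∀ g : 𝓢(Phase d, ℂ), v (phaseFourier d g) = 0 := by
    intro g
    have hl := ((v.continuous.comp (phaseFourier d).continuous).tendsto _).comp
      (tendsto_mulSchwartz_dilate hX g r hr1 hr)
    exact tendsto_nhds_unique hl (tendsto_const_nhds.congr fun n => (h1 n g).symm)
  obtain ⟨G, rfl⟩ := surjective_phaseFourier d g
  exact h2 G

/-- A tempered distribution which vanishes on the complex conjugates of the Wigner distributions of
all Schwartz functions vanishes: the map from a tensor product to the Wigner distribution is the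
composition of a linear change of variables and a partial Fourier transform, both of which are onto. -/
theorem eq_zero_of_weylForm_eq_zero (u : 𝓢'(Phase d, ℂ))
    (hu : ∀ ξ ψ : 𝓢(Config d, ℂ), weylForm u ξ ψ = 0) : u = 0 := by
  let u' : 𝓢(Phase d, ℂ) →L[ℂ] ℂ := u
  let J : 𝓢(Phase d, ℂ) →L[ℝ] 𝓢(Phase d, ℂ) :=
    SchwartzMap.postcompCLM (𝕜 := ℝ) (Complex.conjCLE : ℂ →L[ℝ] ℂ)
  let A : 𝓢(Phase d, ℂ) →L[ℝ] 𝓢(Phase d, ℂ) :=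
    SchwartzMap.compCLMOfContinuousLinearEquiv ℝ (wignerChange d)
  let A' : 𝓢(Phase d, ℂ) →L[ℝ] 𝓢(Phase d, ℂ) :=
    SchwartzMap.compCLMOfContinuousLinearEquiv ℝ (wignerChange d).symm
  let v : 𝓢(Phase d, ℂ) →L[ℝ] ℂ :=
    ((u'.restrictScalars ℝ ∘L J) ∘L partialFourierCLM d) ∘L A
  have hv : ∀ g, v g = 0 := eq_zero_of_tensorSchwartz v fun ψ ξ => by
    have h1 := hu (conjSchwartz ξ) ψ
    have h2 : conjSchwartz (conjSchwartz ξ) = ξ := by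
      ext x
      simp
    rw [weylForm, wignerSchwartz, h2] at h1
    exact h1
  refine DFunLike.ext _ _ fun g => ?_
  obtain ⟨G, hG⟩ := surjective_partialFourierCLM d (conjSchwartz g)
  have h3 : A (A' G) = G := by
    ext z
    change G ((wignerChange d).symm (wignerChange d z)) = G z
    rw [ContinuousLinearEquiv.symm_apply_apply]
  have h4 : J (conjSchwartz g) = g := by
    ext z
    exact Complex.conj_conj _
  have h5 : v (A' G) = u' (J (partialFourierCLM d (A (A' G)))) := rfl
  rw [h3, hG, h4, hv] at h5
  exact h5.symm

end Uniqueness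

/-! ### Positive operators of finite trace -/

section PositiveOperators

variable {H : Type} [NormedAddCommGroup H] [InnerProductSpace ℂ H] [CompleteSpace H]

/-- The Cauchy–Schwarz inequality for the form of a positive operator, with `C = ‖√S‖²`. -/
theorem exists_norm_sq_apply_le {S : H →L[ℂ] H} (hS : S.IsPositive) :
    ∃ C : ℝ, 0 ≤ C ∧ ∀ x, ‖S x‖ ^ 2 ≤ C * (⟪x, S x⟫_ℂ).re := by
  have h0 : 0 ≤ S := (ContinuousLinearMap.nonneg_iff_isPositive S).2 hS
  have hR : CFC.sqrt S * CFC.sqrt S = S := CFC.sqrt_mul_sqrt_self S h0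
  have hRp := (ContinuousLinearMap.nonneg_iff_isPositive (CFC.sqrt S)).1 (CFC.sqrt_nonneg S)
  generalize CFC.sqrt S = R at hR hRp
  refine ⟨‖R‖ ^ 2, by positivity, fun x => ?_⟩
  have h1 : S x = R (R x) := by rw [← hR]; rfl
  have h2 : (⟪x, S x⟫_ℂ).re = ‖R x‖ ^ 2 := by
    rw [h1, ← hRp.inner_left_eq_inner_right, ← RCLike.re_eq_complex_re, inner_self_eq_norm_sq]
  rw [h2, h1, ← mul_pow]
  gcongr
  exact R.le_opNorm _

theorem summable_norm_sq_apply {S : H →L[ℂ] H} (hS : S.IsPositive) {ι : Type} {e : ι → H}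
    (h : Summable fun i => (⟪e i, S (e i)⟫_ℂ).re) : Summable fun i => ‖S (e i)‖ ^ 2 := by
  obtain ⟨C, -, hC⟩ := exists_norm_sq_apply_le hS
  exact Summable.of_nonneg_of_le (fun i => by positivity) (fun i => hC (e i)) (h.mul_left C)

/-- A Hilbert–Schmidt operator is compact: it is the limit of its compositions with the orthogonal
projections on finitely many basis vectors. -/
theorem isCompactOperator_of_summable_norm_sq (T : H →L[ℂ] H) {ι : Type} (e : HilbertBasis ι ℂ H)
    (h : Summable fun i => ‖T (e i)‖ ^ 2) : IsCompactOperator T := by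
  classical
  let P : Finset ι → H →L[ℂ] H := fun F => ∑ i ∈ F, (innerSL ℂ (e i)).smulRight (T (e i))
  have hP : ∀ F x, P F x = ∑ i ∈ F, ⟪e i, x⟫_ℂ • T (e i) := fun F x => by
    simp [P]
  have hPc : ∀ F, IsCompactOperator (P F) := by
    intro F
    induction F using Finset.induction_on with
    | empty => simpa [P] using isCompactOperator_zero
    | insert a F ha ih =>
      have h1 : P (insert a F) = (innerSL ℂ (e a)).smulRight (T (e a)) + P F :=
        Finset.sum_insert ha
      rw [h1]
      refine IsCompactOperator.add ?_ ih
      have h2 : IsCompactOperator (ContinuousLinearMap.toSpanSingleton ℂ (T (e a))) :=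
        isCompactOperator_of_locallyCompactSpace_rng _
      exact h2.comp_clm (innerSL ℂ (e a))
  have hsum : ∀ x, HasSum (fun i => ⟪e i, x⟫_ℂ • T (e i)) (T x) := fun x => by
    have h1 := (e.hasSum_repr x).mapL T
    simpa only [e.repr_apply_apply, map_smul] using h1
  refine isClosed_setOfPred_isCompactOperator.closure_subset (Metric.mem_closure_iff.2
    fun ε hε => ?_)
  obtain ⟨F, hF⟩ := summable_iff_vanishing_norm.1 h ((ε / 2) ^ 2) (by positivity)
  refine ⟨P F, hPc F, ?_⟩
  rw [dist_eq_norm]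
  refine lt_of_le_of_lt (ContinuousLinearMap.opNorm_le_bound _ (by positivity) fun x => ?_)
    (half_lt_self hε)
  have hlim : Filter.Tendsto (fun G : Finset ι => ‖∑ i ∈ G, ⟪e i, x⟫_ℂ • T (e i) - P F x‖)
      Filter.atTop (nhds ‖(T - P F) x‖) := ((hsum x).sub_const (P F x)).norm
  refine le_of_tendsto hlim ((Filter.eventually_ge_atTop F).mono fun G hG => ?_)
  rw [hP, ← Finset.sum_sdiff hG, add_sub_cancel_right]
  have h1 := hF (G \ F) Finset.sdiff_disjoint
  rw [Real.norm_of_nonneg (Finset.sum_nonneg fun i _ => by positivity)] at h1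
  have h2 := e.orthonormal.sum_inner_products_le (s := G \ F) (x := x)
  calc ‖∑ i ∈ G \ F, ⟪e i, x⟫_ℂ • T (e i)‖ ≤ ∑ i ∈ G \ F, ‖⟪e i, x⟫_ℂ‖ * ‖T (e i)‖ := by
        refine (norm_sum_le _ _).trans (le_of_eq ?_)
        simp only [norm_smul]
    _ ≤ √(∑ i ∈ G \ F, ‖⟪e i, x⟫_ℂ‖ ^ 2) * √(∑ i ∈ G \ F, ‖T (e i)‖ ^ 2) :=
        Real.sum_mul_le_sqrt_mul_sqrt _ _ _
    _ ≤ √(‖x‖ ^ 2) * √((ε / 2) ^ 2) := by gcongr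
    _ = ε / 2 * ‖x‖ := by
        rw [Real.sqrt_sq (norm_nonneg x), Real.sqrt_sq (by positivity), mul_comm]

/-- A positive operator whose trace is one in every basis is a density operator. -/
theorem isDensityOperator_of_isPositive {S : H →L[ℂ] H} (hS : S.IsPositive) (hT : HasTrace S 1) :
    IsDensityOperator S := by
  have hsum : ∀ (ι : Type) (e : HilbertBasis ι ℂ H), Summable fun i => (⟪e i, S (e i)⟫_ℂ).re :=
    fun ι e => (Complex.hasSum_re (hT ι e)).summable
  refine ⟨hS, ⟨?_, fun ι e => ?_⟩, hT⟩
  · obtain ⟨w, e, -⟩ := exists_hilbertBasis ℂ H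
    exact isCompactOperator_of_summable_norm_sq S e (summable_norm_sq_apply hS (hsum _ e))
  · rw [CFC.abs_of_nonneg S ((ContinuousLinearMap.nonneg_iff_isPositive S).2 hS)]
    exact hsum ι e

/-- The operator `S` with `⟨ψ, S ξ⟩ = ⟨B(ψ, ξ), k⟩`, for a sesquilinear map `B` into a Hilbert
space and a vector `k` of that space. -/
def operatorOfSesquilinear {K : Type} [NormedAddCommGroup K] [InnerProductSpace ℂ K]
    [CompleteSpace K] (B : H →L[ℂ] H →L⋆[ℂ] K) (k : K) : H →L[ℂ] H :=
  LinearMap.mkContinuous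
    { toFun := fun ξ => ContinuousLinearMap.adjoint (B.flip ξ) k
      map_add' := fun ξ ξ' => by simp
      map_smul' := fun c ξ => ext_inner_left ℂ fun ψ => by
        simp [ContinuousLinearMap.adjoint_inner_right, inner_smul_left, inner_smul_right] }
    (‖B.flip‖ * ‖k‖) (fun ξ => by
      change ‖ContinuousLinearMap.adjoint (B.flip ξ) k‖ ≤ _
      refine (ContinuousLinearMap.le_opNorm _ _).trans ?_
      rw [LinearIsometryEquiv.norm_map, mul_right_comm]
      gcongr
      exact ContinuousLinearMap.le_opNorm _ _)

theorem inner_operatorOfSesquilinear {K : Type} [NormedAddCommGroup K] [InnerProductSpace ℂ K]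
    [CompleteSpace K] (B : H →L[ℂ] H →L⋆[ℂ] K) (k : K) (ψ ξ : H) :
    ⟪ψ, operatorOfSesquilinear B k ξ⟫_ℂ = ⟪B ψ ξ, k⟫_ℂ :=
  ContinuousLinearMap.adjoint_inner_right (B.flip ξ) ψ k

end PositiveOperators

/-! ### Weyl symbols in `L²` -/

section Symbols

variable {d : ℕ}

theorem inner_wignerL_eq_integral (ψ ξ : L2 d) (φ : Lp ℂ 2 (volume : Measure (Phase d))) :
    ⟪wignerL d ψ ξ, φ⟫_ℂ = ∫ z, starRingEnd ℂ (wigner ψ ξ z) * φ z := by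
  rw [L2.inner_def]
  refine integral_congr_ae ((coeFn_wignerL ψ ξ).mono fun z hz => ?_)
  simp only [hz, RCLike.inner_apply']

theorem weylForm_toTemperedDistribution (φ : Lp ℂ 2 (volume : Measure (Phase d)))
    (ξ ψ : 𝓢(Config d, ℂ)) :
    weylForm (Lp.toTemperedDistribution φ) ξ ψ =
      ⟪wignerL d (ψ.toLp 2 volume) (ξ.toLp 2 volume), φ⟫_ℂ := by
  rw [weylForm, Lp.toTemperedDistribution_apply, inner_wignerL_eq_integral, wigner_toLp]
  rfl

/-- The bounded operator with Weyl symbol `φ ∈ L²`, given by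
`⟨ψ, S ξ⟩ = ⟨W(ψ, ξ), φ⟩` (antilinear in the first slots). -/
def weylOperator (φ : Lp ℂ 2 (volume : Measure (Phase d))) : L2 d →L[ℂ] L2 d :=
  operatorOfSesquilinear (wignerL d) φ

theorem inner_weylOperator (φ : Lp ℂ 2 (volume : Measure (Phase d))) (ψ ξ : L2 d) :
    ⟪ψ, weylOperator φ ξ⟫_ℂ = ⟪wignerL d ψ ξ, φ⟫_ℂ :=
  inner_operatorOfSesquilinear _ _ _ _

theorem isWeylTransform_weylOperator (φ : Lp ℂ 2 (volume : Measure (Phase d))) :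
    IsWeylTransform (Lp.toTemperedDistribution φ) (weylOperator φ) := fun ξ ψ => by
  rw [inner_weylOperator, weylForm_toTemperedDistribution]

theorem weylOperator_eq_of_isWeylTransform {φ : Lp ℂ 2 (volume : Measure (Phase d))}
    {S : L2 d →L[ℂ] L2 d} (h : IsWeylTransform (Lp.toTemperedDistribution φ) S) :
    weylOperator φ = S := by
  refine ContinuousLinearMap.ext fun ξ => ext_inner_left ℂ fun ψ => ?_
  obtain ⟨s, hs⟩ := exists_schwartz_tendsto ψ
  obtain ⟨r, hr⟩ := exists_schwartz_tendsto ξ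
  have h1 := hs.inner (𝕜 := ℂ) (((weylOperator φ).continuous.tendsto ξ).comp hr)
  have h2 := hs.inner (𝕜 := ℂ) ((S.continuous.tendsto ξ).comp hr)
  refine tendsto_nhds_unique h1 (h2.congr fun n => ?_)
  exact (h (r n) (s n)).trans (isWeylTransform_weylOperator φ (r n) (s n)).symm

/-- For fixed `ξ` of norm one, `ψ ↦ W(ψ, ξ)` is an isometry. -/
def wignerIsometry (ξ : L2 d) (hξ : ‖ξ‖ = 1) : L2 d →ₗᵢ[ℂ] Lp ℂ 2 (volume : Measure (Phase d)) :=
  ((wignerL d).flip ξ).toLinearMap.isometryOfInner fun ψ ψ' => by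
    change ⟪wignerL d ψ ξ, wignerL d ψ' ξ⟫_ℂ = _
    rw [inner_wignerL, inner_self_eq_norm_sq_to_K, hξ]
    simp

/-- A positive operator of finite trace has a Weyl symbol in `L²`: in an orthonormal basis `(eⱼ)`
this is the orthogonal series `∑ⱼ W(S eⱼ, eⱼ)`. -/
theorem exists_symbol_of_isPositive {S : L2 d →L[ℂ] L2 d} (hS : S.IsPositive) (hT : HasTrace S 1) :
    ∃ φ : Lp ℂ 2 (volume : Measure (Phase d)), ∀ ψ ξ : L2 d,
      ⟪wignerL d ψ ξ, φ⟫_ℂ = ⟪ψ, S ξ⟫_ℂ := by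
  obtain ⟨w, e, -⟩ := exists_hilbertBasis ℂ (L2 d)
  have hsum := summable_norm_sq_apply hS (Complex.hasSum_re (hT _ e)).summable
  have hV : OrthogonalFamily ℂ (fun _ : w => L2 d)
      (fun j => wignerIsometry (e j) (e.orthonormal.1 j)) := by
    intro i j hij ψ ψ'
    change ⟪wignerL d ψ (e i), wignerL d ψ' (e j)⟫_ℂ = 0
    rw [inner_wignerL, e.orthonormal.2 hij.symm, mul_zero]
  obtain ⟨φ, h1⟩ := (hV.summable_iff_norm_sq_summable fun j => S (e j)).2 hsum
  refine ⟨φ, fun ψ ξ => ?_⟩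
  have h2 := h1.mapL (innerSL ℂ (wignerL d ψ ξ))
  have h3 := e.hasSum_inner_mul_inner (ContinuousLinearMap.adjoint S ψ) ξ
  rw [ContinuousLinearMap.adjoint_inner_left] at h3
  have h4 : ∀ j, ⟪ContinuousLinearMap.adjoint S ψ, e j⟫_ℂ * ⟪e j, ξ⟫_ℂ =
      innerSL ℂ (wignerL d ψ ξ) (wignerIsometry (e j) (e.orthonormal.1 j) (S (e j))) := fun j => by
    change _ = ⟪wignerL d ψ ξ, wignerL d (S (e j)) (e j)⟫_ℂ
    rw [inner_wignerL, ContinuousLinearMap.adjoint_inner_left]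
  simp only [h4] at h3
  exact h2.unique h3

/-- A symbol of a density operator is given by a function in `L²`. -/
theorem exists_toTemperedDistribution_eq {u : 𝓢'(Phase d, ℂ)} (hu : u ∈ densitySymbols d) :
    ∃ φ : Lp ℂ 2 (volume : Measure (Phase d)), Lp.toTemperedDistribution φ = u := by
  obtain ⟨S, hS, hp, -, hT⟩ := hu
  obtain ⟨φ, hφ⟩ := exists_symbol_of_isPositive hp hT
  refine ⟨φ, sub_eq_zero.1 (eq_zero_of_weylForm_eq_zero _ fun ξ ψ => ?_)⟩
  have h1 : weylForm (Lp.toTemperedDistribution φ - u) ξ ψ =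
      weylForm (Lp.toTemperedDistribution φ) ξ ψ - weylForm u ξ ψ := rfl
  rw [h1, weylForm_toTemperedDistribution, hφ, hS, sub_self]

end Symbols

/-! ### Convolution of an integrable with a square integrable function -/

section Young

variable {d : ℕ} {f : Phase d → ℝ} {φ g : Phase d → ℂ}

theorem integrable_convolution_integrand_norm_sq (hf : Integrable f) (hφ : MemLp φ 2 volume) :
    Integrable (fun p : Phase d × Phase d => |f p.2| * ‖φ (p.1 - p.2)‖ ^ 2)
      (volume.prod volume) :=
  hf.abs.convolution_integrand (ContinuousLinearMap.mul ℝ ℝ)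
    ((memLp_two_iff_integrable_sq_norm hφ.1).1 hφ)

/-- The absolute convergence behind the existence of `⟨g, f ∗ φ⟩`: the integrand is dominated through
`2 |g| |φ| ≤ |g|² + |φ|²`. -/
theorem integrable_mul_convolution_integrand (hf : Integrable f) (hφ : MemLp φ 2 volume)
    (hg : MemLp g 2 volume) :
    Integrable (fun p : Phase d × Phase d => g p.1 * (f p.2 • φ (p.1 - p.2)))
      (volume.prod volume) := by
  have h1 : Integrable (fun p : Phase d × Phase d => ‖g p.1‖ ^ 2 * |f p.2|)
      (volume.prod volume) :=
    ((memLp_two_iff_integrable_sq_norm hg.1).1 hg).mul_prod hf.abs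
  refine (h1.add (integrable_convolution_integrand_norm_sq hf hφ)).mono'
    (hg.1.comp_fst.mul (hf.1.convolution_integrand (ContinuousLinearMap.lsmul ℝ ℝ) hφ.1))
    (Filter.Eventually.of_forall fun p => ?_)
  rw [norm_mul, norm_smul, Real.norm_eq_abs, Pi.add_apply]
  nlinarith [mul_nonneg (abs_nonneg (f p.2)) (sq_nonneg (‖g p.1‖ - ‖φ (p.1 - p.2)‖)),
    mul_nonneg (abs_nonneg (f p.2)) (sq_nonneg ‖g p.1‖),
    mul_nonneg (abs_nonneg (f p.2)) (sq_nonneg ‖φ (p.1 - p.2)‖)]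

theorem convolutionExistsAt_of_integrable_norm_sq (hf : Integrable f) (hφ : MemLp φ 2 volume)
    {z : Phase d} (h : Integrable fun t => |f t| * ‖φ (z - t)‖ ^ 2) :
    ConvolutionExistsAt f φ z (ContinuousLinearMap.lsmul ℝ ℝ) volume := by
  refine (hf.abs.add h).mono' (hf.1.convolution_integrand_snd _ hφ.1 z)
    (Filter.Eventually.of_forall fun t => ?_)
  rw [ContinuousLinearMap.lsmul_apply, norm_smul, Real.norm_eq_abs, Pi.add_apply]
  nlinarith [mul_nonneg (abs_nonneg (f t)) (sq_nonneg (‖φ (z - t)‖ - 1)),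
    mul_nonneg (abs_nonneg (f t)) (sq_nonneg ‖φ (z - t)‖), abs_nonneg (f t)]

theorem ae_convolutionExistsAt (hf : Integrable f) (hφ : MemLp φ 2 volume) :
    ∀ᵐ z, ConvolutionExistsAt f φ z (ContinuousLinearMap.lsmul ℝ ℝ) volume :=
  (integrable_convolution_integrand_norm_sq hf hφ).prod_right_ae.mono fun _ h =>
    convolutionExistsAt_of_integrable_norm_sq hf hφ h

/-- The Cauchy–Schwarz inequality `|f ∗ φ|² ≤ ‖f‖₁ (|f| ∗ |φ|²)`. -/
theorem norm_conv_sq_le (hf : Integrable f) (hφ : MemLp φ 2 volume) {z : Phase d}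
    (h : Integrable fun t => |f t| * ‖φ (z - t)‖ ^ 2) :
    ‖conv f φ z‖ ^ 2 ≤ (∫ t, |f t|) * ∫ t, |f t| * ‖φ (z - t)‖ ^ 2 := by
  have h1 : Integrable fun t => |f t| * ‖φ (z - t)‖ :=
    ((convolutionExistsAt_of_integrable_norm_sq hf hφ h).norm).congr
      (Filter.Eventually.of_forall fun t => by
        simp only [ContinuousLinearMap.lsmul_apply, norm_smul, Real.norm_eq_abs])
  have h2 : ‖conv f φ z‖ ≤ ∫ t, |f t| * ‖φ (z - t)‖ := by
    refine (norm_integral_le_integral_norm _).trans (le_of_eq ?_)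
    simp only [ContinuousLinearMap.lsmul_apply, norm_smul, Real.norm_eq_abs]
  -- the quadratic polynomial `c ↦ ∫ |f t| (c - |φ (z - t)|)²` has no negative values
  have h3 : ∀ c : ℝ, 0 ≤ (∫ t, |f t|) * (c * c) + (-2 * ∫ t, |f t| * ‖φ (z - t)‖) * c +
      ∫ t, |f t| * ‖φ (z - t)‖ ^ 2 := fun c => by
    have h4 : 0 ≤ ∫ t, |f t| * (c - ‖φ (z - t)‖) ^ 2 :=
      integral_nonneg fun t => by positivity
    have h5 : (fun t => |f t| * (c - ‖φ (z - t)‖) ^ 2) = fun t =>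
        (|f t| * (c * c) + |f t| * ‖φ (z - t)‖ * (-2 * c)) + |f t| * ‖φ (z - t)‖ ^ 2 := by
      funext t; ring
    have h6 : Integrable fun t => |f t| * (c * c) + |f t| * ‖φ (z - t)‖ * (-2 * c) :=
      (hf.abs.mul_const _).add (h1.mul_const _)
    rw [h5, integral_add h6 h, integral_add (hf.abs.mul_const _) (h1.mul_const _),
      integral_mul_const, integral_mul_const] at h4
    linarith
  have h6 := discrim_le_zero h3
  rw [discrim] at h6
  have h7 := pow_le_pow_left₀ (norm_nonneg _) h2 2
  linarith

/-- Young's inequality for `L¹ ∗ L²`, in qualitative form. -/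
theorem memLp_conv (hf : Integrable f) (hφ : MemLp φ 2 volume) : MemLp (conv f φ) 2 volume := by
  have hm : AEStronglyMeasurable (conv f φ) volume :=
    (hf.1.convolution_integrand (ContinuousLinearMap.lsmul ℝ ℝ) hφ.1).integral_prod_right'
  have h := integrable_convolution_integrand_norm_sq hf hφ
  rw [memLp_two_iff_integrable_sq_norm hm]
  refine (h.integral_prod_left.const_mul (∫ t, |f t|)).mono' (hm.norm.pow 2) ?_
  filter_upwards [h.prod_right_ae] with z hz
  rw [Real.norm_of_nonneg (by positivity)]
  exact norm_conv_sq_le hf hφ hz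

/-- The pairing of `g` with `f ∗ φ`, by Fubini's theorem. -/
theorem integral_mul_conv (hf : Integrable f) (hφ : MemLp φ 2 volume) (hg : MemLp g 2 volume) :
    ∫ x, g x * conv f φ x = ∫ y, f y • ∫ x, g x * φ (x - y) := by
  calc ∫ x, g x * conv f φ x = ∫ x, ∫ y, g x * (f y • φ (x - y)) := by
        refine integral_congr_ae (Filter.Eventually.of_forall fun x => ?_)
        exact (integral_const_mul _ _).symm
    _ = ∫ y, ∫ x, g x * (f y • φ (x - y)) :=
        integral_integral_swap (integrable_mul_convolution_integrand hf hφ hg)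
    _ = _ := by
        refine integral_congr_ae (Filter.Eventually.of_forall fun y => ?_)
        simp only [mul_smul_comm, integral_smul]

theorem integrable_smul_integral_mul_sub (hf : Integrable f) (hφ : MemLp φ 2 volume)
    (hg : MemLp g 2 volume) : Integrable fun y => f y • ∫ x, g x * φ (x - y) := by
  refine (integrable_mul_convolution_integrand hf hφ hg).integral_prod_right.congr
    (Filter.Eventually.of_forall fun y => ?_)
  simp only [mul_smul_comm, integral_smul]

theorem integral_mul_sub_eq (y : Phase d) :
    ∫ x, g x * φ (x - y) = ∫ x, g (x + y) * φ x := by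
  rw [← integral_add_right_eq_self (fun x => g x * φ (x - y)) y]
  simp only [add_sub_cancel_right]

end Young

/-! ### Cohen's class -/

section Cohen

variable {d : ℕ} {f : Phase d → ℝ} {φ : Phase d → ℂ}

instance : (volume : Measure (Phase d)).IsNegInvariant :=
  Measure.IsAddHaarMeasure.isNegInvariant_of_regular _

theorem memLp_comp_sub_left {g : Phase d → ℂ} (hg : MemLp g 2 volume) (z : Phase d) :
    MemLp (fun x => g (z - x)) 2 volume :=
  hg.comp_measurePreserving (Measure.measurePreserving_sub_left volume z)

theorem convolutionExists_wigner (hφ : MemLp φ 2 volume) (ψ : L2 d) :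
    ConvolutionExists (wigner ψ ψ) φ (ContinuousLinearMap.mul ℂ ℂ) volume := fun z =>
  (memLp_wigner ψ ψ).integrable_mul (memLp_comp_sub_left hφ z)

theorem cohen_eq_integral (φ : Phase d → ℂ) (ψ : Config d → ℂ) (z : Phase d) :
    cohen φ ψ z = ∫ x, wigner ψ ψ (z - x) * φ x :=
  convolution_eq_swap _

theorem cohen_sub (φ : Phase d → ℂ) (ψ : Config d → ℂ) (z y : Phase d) :
    cohen φ ψ (z - y) = ∫ x, wigner ψ ψ (z - x) * φ (x - y) := by
  rw [cohen_eq_integral, integral_mul_sub_eq (g := fun x => wigner ψ ψ (z - x))]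
  simp only [sub_add_eq_sub_sub_swap]

theorem convolutionExists_cohen (hf : Integrable f) (hφ : MemLp φ 2 volume) (ψ : L2 d) :
    ConvolutionExists f (cohen φ ψ) (ContinuousLinearMap.lsmul ℝ ℝ) volume := fun z => by
  have h := integrable_smul_integral_mul_sub hf hφ (memLp_comp_sub_left (memLp_wigner ψ ψ) z)
  simp only [← cohen_sub] at h
  exact h

theorem cohen_conv (hf : Integrable f) (hφ : MemLp φ 2 volume) (ψ : L2 d) :
    cohen (conv f φ) ψ = conv f (cohen φ ψ) := by
  funext z
  rw [cohen_eq_integral, integral_mul_conv hf hφ (memLp_comp_sub_left (memLp_wigner ψ ψ) z)]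
  simp only [← cohen_sub]
  rfl

end Cohen

/-! ### Phase space shifts and covariance of the Wigner distribution -/

section Shift

variable {d : ℕ}

/-- The phase space shift by `-y`, for `y = (a, b)`: the function
`t ↦ exp(-2πi b · t) g(t + a)`. -/
def shift (y : Phase d) (g : Config d → ℂ) (t : Config d) : ℂ :=
  ((Real.fourierChar (-⟪t, y.2⟫_ℝ) : Circle) : ℂ) * g (t + y.1)

theorem norm_shift (y : Phase d) (g : Config d → ℂ) (t : Config d) :
    ‖shift y g t‖ = ‖g (t + y.1)‖ := by
  rw [shift, norm_mul, Circle.norm_coe, one_mul]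

theorem continuous_shift_char (b : Config d) :
    Continuous fun t : Config d => ((Real.fourierChar (-⟪t, b⟫_ℝ) : Circle) : ℂ) :=
  continuous_subtype_val.comp (Real.continuous_fourierChar.comp (by fun_prop))

theorem memLp_shift (y : Phase d) {g : Config d → ℂ} (hg : MemLp g 2 volume) :
    MemLp (shift y g) 2 volume := by
  have h := hg.comp_measurePreserving (measurePreserving_add_right volume y.1)
  exact h.of_le ((continuous_shift_char y.2).aestronglyMeasurable.mul h.1)
    (Filter.Eventually.of_forall fun t => (norm_shift y g t).le)

theorem eLpNorm_shift (y : Phase d) {g : Config d → ℂ} (hg : MemLp g 2 volume) :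
    eLpNorm (shift y g) 2 volume = eLpNorm g 2 volume := by
  rw [← eLpNorm_comp_measurePreserving hg.1 (measurePreserving_add_right volume y.1)]
  exact eLpNorm_congr_norm_ae (Filter.Eventually.of_forall fun t => norm_shift y g t)

theorem shift_congr_ae (y : Phase d) {g h : Config d → ℂ} (hgh : g =ᵐ[volume] h) :
    shift y g =ᵐ[volume] shift y h := by
  have h1 := (measurePreserving_add_right volume y.1).quasiMeasurePreserving.ae_eq_comp hgh
  filter_upwards [h1] with t ht
  rw [shift, shift]
  exact congrArg _ ht

/-- Covariance of the Wigner distribution under phase space shifts. -/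
theorem wigner_shift (y : Phase d) (g : Config d → ℂ) (z : Phase d) :
    wigner (shift y g) (shift y g) z = wigner g g (z + y) := by
  rw [wigner, wigner, Real.fourier_eq, Real.fourier_eq]
  refine integral_congr_ae (Filter.Eventually.of_forall fun t => ?_)
  simp only [shift, Circle.smul_def, smul_eq_mul, map_mul, Prod.fst_add, Prod.snd_add]
  rw [add_right_comm, sub_add_eq_add_sub, ← Circle.coe_inv_eq_conj, ← AddChar.map_neg_eq_inv,
    inner_add_right, neg_add, AddChar.map_add_eq_mul, Circle.coe_mul]
  have h : ((Real.fourierChar (-⟪z.1 + (1 / 2 : ℝ) • t, y.2⟫_ℝ) : Circle) : ℂ) *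
      ((Real.fourierChar (- -⟪z.1 - (1 / 2 : ℝ) • t, y.2⟫_ℝ) : Circle) : ℂ) =
      ((Real.fourierChar (-⟪t, y.2⟫_ℝ) : Circle) : ℂ) := by
    rw [← Circle.coe_mul, ← AddChar.map_add_eq_mul]
    congr 3
    rw [inner_add_left, inner_sub_left, real_inner_smul_left]
    ring
  rw [← h]
  ring

/-- The phase space shift as a linear isometry of `L²`. -/
def shiftIsometry (y : Phase d) : L2 d →ₗᵢ[ℂ] L2 d where
  toFun ψ := (memLp_shift y (Lp.memLp ψ)).toLp _
  map_add' ψ ξ := by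
    rw [← MemLp.toLp_add]
    refine MemLp.toLp_congr _ _ ((shift_congr_ae y (Lp.coeFn_add ψ ξ)).trans
      (Filter.Eventually.of_forall fun t => ?_))
    simp only [shift, Pi.add_apply, mul_add]
  map_smul' c ψ := by
    rw [RingHom.id_apply, ← MemLp.toLp_const_smul]
    refine MemLp.toLp_congr _ _ ((shift_congr_ae y (Lp.coeFn_smul c ψ)).trans
      (Filter.Eventually.of_forall fun t => ?_))
    simp only [shift, Pi.smul_apply, smul_eq_mul, mul_left_comm]
  norm_map' ψ := by
    change ‖(memLp_shift y (Lp.memLp ψ)).toLp _‖ = _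
    rw [Lp.norm_toLp, eLpNorm_shift y (Lp.memLp ψ), Lp.norm_def]

theorem coeFn_shiftIsometry (y : Phase d) (ψ : L2 d) :
    shiftIsometry y ψ =ᵐ[volume] shift y ψ :=
  MemLp.coeFn_toLp (memLp_shift y (Lp.memLp ψ))

theorem wigner_shiftIsometry (y : Phase d) (ψ : L2 d) (z : Phase d) :
    wigner (shiftIsometry y ψ) (shiftIsometry y ψ) z = wigner ψ ψ (z + y) := by
  rw [wigner_congr_ae (coeFn_shiftIsometry y ψ) (coeFn_shiftIsometry y ψ), wigner_shift]

theorem shift_shift_neg (y : Phase d) (g : Config d → ℂ) (t : Config d) :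
    shift y (shift (-y) g) t = ((Real.fourierChar ⟪y.1, y.2⟫_ℝ : Circle) : ℂ) * g t := by
  simp only [shift, Prod.fst_neg, Prod.snd_neg, inner_neg_right, neg_neg, add_neg_cancel_right]
  rw [← mul_assoc, ← Circle.coe_mul, ← AddChar.map_add_eq_mul]
  congr 4
  rw [inner_add_left]
  ring

theorem surjective_shiftIsometry (y : Phase d) : Function.Surjective (shiftIsometry y) := by
  intro ξ
  set c : Circle := Real.fourierChar ⟪y.1, y.2⟫_ℝ with hc
  refine ⟨((c⁻¹ : Circle) : ℂ) • shiftIsometry (-y) ξ, Lp.ext ?_⟩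
  rw [map_smul]
  have h1 := (coeFn_shiftIsometry y (shiftIsometry (-y) ξ)).trans
    (shift_congr_ae y (coeFn_shiftIsometry (-y) ξ))
  filter_upwards [h1, Lp.coeFn_smul ((c⁻¹ : Circle) : ℂ)
    (shiftIsometry y (shiftIsometry (-y) ξ))] with t h1 h2
  rw [h2, Pi.smul_apply, h1, shift_shift_neg, smul_eq_mul, ← mul_assoc, ← hc, ← Circle.coe_mul,
    inv_mul_cancel, Circle.coe_one, one_mul]

/-- The image of an orthonormal basis under a phase space shift. -/
def shiftBasis (y : Phase d) {ι : Type} (e : HilbertBasis ι ℂ (L2 d)) : HilbertBasis ι ℂ (L2 d) :=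
  HilbertBasis.ofRepr ((LinearIsometryEquiv.ofSurjective (shiftIsometry y)
    (surjective_shiftIsometry y)).symm.trans e.repr)

theorem shiftBasis_apply (y : Phase d) {ι : Type} (e : HilbertBasis ι ℂ (L2 d)) (i : ι) :
    shiftBasis y e i = shiftIsometry y (e i) := by
  classical
  rw [← HilbertBasis.repr_symm_single, ← HilbertBasis.repr_symm_single]
  rfl

end Shift

/-! ### Averages of a density operator over phase space shifts -/

section Average

variable {d : ℕ}

/-- The space `L²` is separable, and the balls of radius `1 / 2` around the vectors of an orthonormal
family are disjoint. -/
theorem countable_of_orthonormal {ι : Type} {e : ι → L2 d} (he : Orthonormal ℂ e) :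
    Countable ι := by
  have : Fact ((2 : ℝ≥0∞) ≠ ⊤) := ⟨by simp⟩
  refine Pairwise.countable_of_isOpen_disjoint (s := fun i => Metric.ball (e i) (1 / 2))
    (fun i j hij => Metric.ball_disjoint_ball ?_) (fun i => Metric.isOpen_ball)
    (fun i => ⟨e i, Metric.mem_ball_self (by norm_num)⟩)
  have h := norm_sub_sq (𝕜 := ℂ) (e i) (e j)
  rw [he.1 i, he.1 j, he.2 hij, map_zero] at h
  rw [dist_eq_norm]
  nlinarith [norm_nonneg (e i - e j)]

variable {f : Phase d → ℝ} {φ : Lp ℂ 2 (volume : Measure (Phase d))}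

theorem integral_conj_wigner_mul_sub (ψ : L2 d) (y : Phase d) :
    ∫ x, starRingEnd ℂ (wigner ψ ψ x) * φ (x - y) =
      ⟪shiftIsometry y ψ, weylOperator φ (shiftIsometry y ψ)⟫_ℂ := by
  rw [integral_mul_sub_eq, inner_weylOperator, inner_wignerL_eq_integral]
  simp only [wigner_shiftIsometry]

/-- The operator with symbol `f ∗ φ` is the average, with weight `f`, of the operators unitarily
equivalent by phase space shifts to the one with symbol `φ`. -/
theorem inner_weylOperator_conv (hf : Integrable f) (ψ : L2 d) :
    ⟪ψ, weylOperator ((memLp_conv hf (Lp.memLp φ)).toLp _) ψ⟫_ℂ =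
      ∫ y, f y • ⟪shiftIsometry y ψ, weylOperator φ (shiftIsometry y ψ)⟫_ℂ := by
  rw [inner_weylOperator, inner_wignerL_eq_integral]
  simp only [← integral_conj_wigner_mul_sub]
  rw [← integral_mul_conv hf (Lp.memLp φ) (memLp_conj (memLp_wigner ψ ψ))]
  refine integral_congr_ae ((MemLp.coeFn_toLp (memLp_conv hf (Lp.memLp φ))).mono fun x hx => ?_)
  simp only [hx]

theorem integrable_smul_inner_shift (hf : Integrable f) (ψ : L2 d) :
    Integrable fun y => f y • ⟪shiftIsometry y ψ, weylOperator φ (shiftIsometry y ψ)⟫_ℂ := by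
  have h := integrable_smul_integral_mul_sub hf (Lp.memLp φ) (memLp_conj (memLp_wigner ψ ψ))
  simpa only [integral_conj_wigner_mul_sub] using h

theorem inner_apply_self_eq_ofReal {S : L2 d →L[ℂ] L2 d} (hS : S.IsPositive) (ψ : L2 d) :
    ⟪ψ, S ψ⟫_ℂ = (((⟪ψ, S ψ⟫_ℂ).re : ℝ) : ℂ) ∧ 0 ≤ (⟪ψ, S ψ⟫_ℂ).re := by
  have h := Complex.nonneg_iff.1 (hS.inner_nonneg_right ψ)
  exact ⟨Complex.ext rfl h.2.symm, h.1⟩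

theorem isPositive_weylOperator_conv (hf : Integrable f) (hf_nonneg : ∀ᵐ z, 0 ≤ f z)
    (hS : (weylOperator φ).IsPositive) :
    (weylOperator ((memLp_conv hf (Lp.memLp φ)).toLp _)).IsPositive := by
  rw [ContinuousLinearMap.isPositive_iff_complex]
  intro ψ
  have h : ⟪ψ, weylOperator ((memLp_conv hf (Lp.memLp φ)).toLp _) ψ⟫_ℂ =
      ((∫ y, f y * (⟪shiftIsometry y ψ, weylOperator φ (shiftIsometry y ψ)⟫_ℂ).re : ℝ) : ℂ) := by
    rw [inner_weylOperator_conv hf, ← integral_complex_ofReal]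
    refine integral_congr_ae (Filter.Eventually.of_forall fun y => ?_)
    simp only
    rw [(inner_apply_self_eq_ofReal hS _).1, Complex.ofReal_re, Complex.real_smul,
      Complex.ofReal_mul]
  rw [← inner_conj_symm, h, Complex.conj_ofReal]
  refine ⟨rfl, integral_nonneg_of_ae (hf_nonneg.mono fun y hy => ?_)⟩
  exact mul_nonneg hy (inner_apply_self_eq_ofReal hS _).2

/-- The trace and the average are exchanged by dominated convergence, since the trace of the shifted
operator in the basis `e` is its trace in the shifted basis. -/
theorem hasTrace_weylOperator_conv (hf : Integrable f) (hf_one : ∫ z, f z = 1)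
    (hS : (weylOperator φ).IsPositive) (hT : HasTrace (weylOperator φ) 1) :
    HasTrace (weylOperator ((memLp_conv hf (Lp.memLp φ)).toLp _)) 1 := by
  intro ι e
  have := countable_of_orthonormal e.orthonormal
  have hy : ∀ y, HasSum (fun i => ⟪shiftIsometry y (e i),
      weylOperator φ (shiftIsometry y (e i))⟫_ℂ) 1 := fun y => by
    simpa only [shiftBasis_apply] using hT ι (shiftBasis y e)
  have hn : ∀ y i, ‖f y • ⟪shiftIsometry y (e i), weylOperator φ (shiftIsometry y (e i))⟫_ℂ‖ =
      |f y| * (⟪shiftIsometry y (e i), weylOperator φ (shiftIsometry y (e i))⟫_ℂ).re :=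
    fun y i => by
      obtain ⟨h1, h2⟩ := inner_apply_self_eq_ofReal hS (shiftIsometry y (e i))
      rw [norm_smul, h1, Complex.norm_real, Real.norm_of_nonneg h2, Complex.ofReal_re,
        Real.norm_eq_abs]
  have hb : ∀ y, HasSum (fun i => ‖f y • ⟪shiftIsometry y (e i),
      weylOperator φ (shiftIsometry y (e i))⟫_ℂ‖) |f y| := fun y => by
    simpa only [hn, Complex.one_re, mul_one] using (Complex.hasSum_re (hy y)).mul_left |f y|
  have h := hasSum_integral_of_dominated_convergence
    (F := fun i y => f y • ⟪shiftIsometry y (e i), weylOperator φ (shiftIsometry y (e i))⟫_ℂ)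
    (f := fun y => f y • (1 : ℂ)) (μ := volume)
    (fun i y => ‖f y • ⟪shiftIsometry y (e i), weylOperator φ (shiftIsometry y (e i))⟫_ℂ‖)
    (fun i => (integrable_smul_inner_shift hf (e i)).1)
    (fun i => Filter.Eventually.of_forall fun y => le_rfl)
    (Filter.Eventually.of_forall fun y => (hb y).summable)
    (by simpa only [(hb _).tsum_eq] using hf.abs)
    (Filter.Eventually.of_forall fun y => (hy y).const_smul (f y))
  rw [integral_smul_const, hf_one, one_smul] at h
  simpa only [inner_weylOperator_conv hf] using h

theorem toTemperedDistribution_conv_mem_densitySymbols (hf : Integrable f)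
    (hf_nonneg : ∀ᵐ z, 0 ≤ f z) (hf_one : ∫ z, f z = 1)
    (hφ : Lp.toTemperedDistribution φ ∈ densitySymbols d) :
    Lp.toTemperedDistribution ((memLp_conv hf (Lp.memLp φ)).toLp (conv f φ)) ∈
      densitySymbols d := by
  obtain ⟨S, hS, hp, -, hT⟩ := hφ
  obtain rfl := weylOperator_eq_of_isWeylTransform hS
  exact ⟨_, isWeylTransform_weylOperator _, isDensityOperator_of_isPositive
    (isPositive_weylOperator_conv hf hf_nonneg hp) (hasTrace_weylOperator_conv hf hf_one hp hT)⟩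

end Average

end CohenClass

end

theorem mainTheorem11 (d : ℕ)
    (f : CohenClass.Phase d → ℝ) (hf : Integrable f) (hf_nonneg : ∀ᵐ z, 0 ≤ f z)
    (hf_one : ∫ z, f z = 1)
    (u : 𝓢'(CohenClass.Phase d, ℂ)) (hu : u ∈ CohenClass.densitySymbols d) :
    (∃ φ : Lp ℂ 2 (volume : Measure (CohenClass.Phase d)), Lp.toTemperedDistribution φ = u) ∧
    ∀ φ : Lp ℂ 2 (volume : Measure (CohenClass.Phase d)), Lp.toTemperedDistribution φ = u →
      (∀ᵐ z, ConvolutionExistsAt f φ z (ContinuousLinearMap.lsmul ℝ ℝ) volume) ∧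
      (∃ h : MemLp (CohenClass.conv f φ) 2,
        Lp.toTemperedDistribution (h.toLp (CohenClass.conv f φ)) ∈ CohenClass.densitySymbols d) ∧
      ∀ ψ : CohenClass.L2 d,
        ConvolutionExists (CohenClass.wigner ψ ψ) φ (ContinuousLinearMap.mul ℂ ℂ) volume ∧
        ConvolutionExists (CohenClass.wigner ψ ψ) (CohenClass.conv f φ)
          (ContinuousLinearMap.mul ℂ ℂ) volume ∧
        ConvolutionExists f (CohenClass.cohen φ ψ) (ContinuousLinearMap.lsmul ℝ ℝ) volume ∧
        CohenClass.cohen (CohenClass.conv f φ) ψ =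
          CohenClass.conv f (CohenClass.cohen φ ψ) := by
  refine ⟨CohenClass.exists_toTemperedDistribution_eq hu, fun φ hφ => ?_⟩
  subst hφ
  have hφ2 := Lp.memLp φ
  exact ⟨CohenClass.ae_convolutionExistsAt hf hφ2, ⟨CohenClass.memLp_conv hf hφ2,
    CohenClass.toTemperedDistribution_conv_mem_densitySymbols hf hf_nonneg hf_one hu⟩,
    fun ψ => ⟨CohenClass.convolutionExists_wigner hφ2 ψ,
      CohenClass.convolutionExists_wigner (CohenClass.memLp_conv hf hφ2) ψ,
      CohenClass.convolutionExists_cohen hf hφ2 ψ, CohenClass.cohen_conv hf hφ2 ψ⟩⟩
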